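/- Let $\Omega\subseteq\mathbb R^m$ be open (in particular, bounded with smooth boundary), $p\ge 1$, $n\in\mathbb N=\{0,1,2,\dots\}$ and $t^\star>0$. Let $\mathcal L$ be a linear operator in $L^2(\Omega)$ with $D(\mathcal L)\supseteq H^p(\Omega)$ and $\mathcal Lv=\sum_{|\beta|\le p}a_\beta\,\partial^\beta v$ for $v\in H^p(\Omega)$, where $a_\beta\in C_b^\infty(\Omega)$ (smooth, all derivatives bounded). Let $\mathcal L$ generate a strongly continuous semigroup $e^{t\mathcal L}$ on $L^2(\Omega)$. Say that the data are *regular of order* $N$ if $e^{t\mathcal L}$ restricts to a strongly continuous semigroup on $H^{jp}(\Omega)$ for every $0\le j\le N$ (well-posedness), $u_0\in H^{Np}(\Omega)$ and $\alpha\in W^{Np,\infty}(\Omega)$. Assume regularity of order $n+1$. All functions are complex valued, and $\alpha$ also denotes the operator of multiplication by $\alpha$. For $\omega>0$ consider $$\partial_t u=\mathcal Lu+\alpha e^{\mathrm i\omega t}u,\quad t\in[0,t^\star],\qquad u(0)=u_0. \tag{1}$$ **Notation.** $\mathrm{ad}^0_{\mathcal L}(B)=B$ and $\mathrm{ad}^{k+1}_{\mathcal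 L}(B)=\mathcal L\,\mathrm{ad}^{k}_{\mathcal L}(B)-\mathrm{ad}^{k}_{\mathcal L}(B)\,\mathcal L$, all operators being taken on their natural domains in $L^2(\Omega)$. For $\mathbf k^d=(k_1,\dots,k_d)\in\mathbb N^d$, $|\mathbf k^d|=k_1+\dots+k_d$: $\mathcal N_{k_l}^{k_r}=\mathrm{Id}$ if $l>r$, $\mathcal N_{k_l}^{k_r}=\mathrm{ad}_{\mathcal L}^{k_r}\big(\alpha\,\mathcal N_{k_l}^{k_{r-1}}\big)$ if $l\le r$ (so $\mathcal N_{k_l}^{k_l}=\mathrm{ad}_{\mathcal L}^{k_l}(\alpha)$); $$a^\ell_j=\prod_{r=0}^{j-1}(j-r)^{-(k_{\ell-r}+1)},\qquad b^\ell_j=j^{-k_\ell}\prod_{r=1}^{j-1}(j-r)^{-(k_{\ell-r}+1)}\ (j\ge1);$$ $\mathcal F_0=\mathrm{Id}$, $\mathcal F_\ell=-\sum_{m=0}^{\ell-1}a^\ell_{\ell-m}\mathcal N_{k_{m+1}}^{k_\ell}\mathcal F_m$. For $1\le d\le N$ put $$S^d_N(t)=\sum_{|\mathbf k^d|=0}^{N-d}\frac1{(\mathrm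 i\omega)^{d+|\mathbf k^d|}}\sum_{\ell=0}^d a^d_{d-\ell}\,e^{(d-\ell)\mathrm i\omega t}\,\mathcal N_{k_{\ell+1}}^{k_d}e^{t\mathcal L}\mathcal F_\ell u_0,$$ and, with $E^0_N=0$, $$E^d_N(t)=\frac1{(\mathrm i\omega)^N}\sum_{|\mathbf k^d|=N-d+1}\ \sum_{\ell=0}^{d-1}b^d_{d-\ell}\int_0^t e^{(d-\ell)\mathrm i\omega\tau}e^{(t-\tau)\mathcal L}\mathcal N_{k_{\ell+1}}^{k_d}e^{\tau\mathcal L}\mathcal F_\ell u_0\,d\tau+\int_0^t e^{(t-\tau)\mathcal L}\alpha e^{\mathrm i\omega\tau}E^{d-1}_N(\tau)\,d\tau .$$ Let $T^0(t)=e^{t\mathcal L}u_0$, $T^{d+1}(t)=\int_0^te^{(t-\tau)\mathcal L}\alpha e^{\mathrm i\omega\tau}T^d(\tau)\,d\tau$, and $Y=C([0,t^\star];L^2(\Omega))$ with the maximum norm. **Theorem.** All vectors $\mathcal N_{k_{\ell+1}}^{k_d}e^{t\mathcal L}\mathcal F_\ell u_0$ with $0\le\ell\le d$ and $|\mathbf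 k^d|\le n+1$ are well defined and depend continuously on $t\in[0,t^\star]$ in $L^2(\Omega)$. There is a constant $C=C^n_R(t^\star,\mathcal L,u_0,\alpha)$, independent of $\omega$, such that the following holds for every $\omega>0$. 1. Every solution $u$ of (1) (that is, $u:[0,t^\star]\to L^2(\Omega)$ differentiable with $u(t)\in D(\mathcal L)$) satisfies on $[0,t^\star]$ $$u(t)=p_{0,0}(t)+\sum_{r=1}^n\frac1{\omega^r}\sum_{s=0}^r p_{r,s}(t)\,e^{\mathrm is\omega t}+R_n(t),$$ where $p_{0,0}(t)=e^{t\mathcal L}u_0$ and, for $r\ge1$, $$p_{r,s}(t)=\sum_{d=\max(s,1)}^{r}\ \sum_{|\mathbf k^d|=r-d}\frac{a^d_s}{\mathrm i^r}\,\mathcal N_{k_{d-s+1}}^{k_d}e^{t\mathcal L}\mathcal F_{d-s}u_0,\qquad R_n(t)=\sum_{d=1}^nE^d_n(t)+\sum_{d=n+1}^\infty T^d(t),$$ with each $T^d\in Y$ and the last series convergent in $Y$. 2. For every $d\ge n+1$ such that the data are regular of order $d$ (in particular for $d=n+1$), $T^d=S^d_d+E^d_d$ on $[0,t^\star]$. In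 particular, if the data are regular of every order, then $$R_n=\sum_{d=1}^nE^d_n+\sum_{d=n+1}^\infty\big(S^d_d+E^d_d\big).$$ 3. $R_n\in Y$ and $\|R_n\|_Y\le\omega^{-(n+1)}\,C$. -/

import Mathlib

open MeasureTheory Set Filter Topology
open scoped ENNReal Distributions LineDeriv

namespace ModFourier

noncomputable section

/-! ### Unbounded operators with their natural domains -/

section Operators

variable {X : Type*} [NormedAddCommGroup X] [NormedSpace ℂ X]

/-- The composition `A B` of two unbounded operators, on its natural domain
`{v ∈ D(B) : B v ∈ D(A)}`. -/
def pcomp (A B : X →ₗ.[ℂ] X) : X →ₗ.[ℂ] X where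
  domain :=
    { carrier := {v | ∃ h : v ∈ B.domain, B ⟨v, h⟩ ∈ A.domain}
      add_mem' := by
        rintro v w ⟨hv, hv'⟩ ⟨hw, hw'⟩
        refine ⟨B.domain.add_mem hv hw, ?_⟩
        have h : B ⟨v + w, B.domain.add_mem hv hw⟩ = B ⟨v, hv⟩ + B ⟨w, hw⟩ :=
          B.map_add ⟨v, hv⟩ ⟨w, hw⟩
        rw [h]
        exact A.domain.add_mem hv' hw'
      zero_mem' := by
        refine ⟨B.domain.zero_mem, ?_⟩
        have h : B ⟨0, B.domain.zero_mem⟩ = 0 := B.map_zero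
        rw [h]
        exact A.domain.zero_mem
      smul_mem' := by
        rintro c v ⟨hv, hv'⟩
        refine ⟨B.domain.smul_mem c hv, ?_⟩
        have h : B ⟨c • v, B.domain.smul_mem c hv⟩ = c • B ⟨v, hv⟩ := B.map_smul c ⟨v, hv⟩
        rw [h]
        exact A.domain.smul_mem c hv' }
  toFun :=
    { toFun := fun v => A ⟨B ⟨v.1, v.2.fst⟩, v.2.snd⟩
      map_add' := by
        intro v w
        rw [← A.map_add]
        congr 1
        exact Subtype.ext (B.map_add ⟨v.1, v.2.fst⟩ ⟨w.1, w.2.fst⟩)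
      map_smul' := by
        intro c v
        rw [RingHom.id_apply, ← A.map_smul]
        congr 1
        exact Subtype.ext (B.map_smul c ⟨v.1, v.2.fst⟩) }

/-- An everywhere defined bounded operator, seen as an unbounded operator. -/
def full (B : X →L[ℂ] X) : X →ₗ.[ℂ] X := B.toLinearMap.toPMap ⊤

open Classical in
/-- The value `A v` for `v ∈ D(A)` (and `0` for `v ∉ D(A)`). -/
def app (A : X →ₗ.[ℂ] X) (v : X) : X := if h : v ∈ A.domain then A ⟨v, h⟩ else 0

/-- `ad_L^0(B) = B`, `ad_L^{k+1}(B) = [L, ad_L^k(B)]` with `[A, B] = A B - B A`. -/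
def adPow (L B : X →ₗ.[ℂ] X) : ℕ → (X →ₗ.[ℂ] X)
  | 0 => B
  | k + 1 => pcomp L (adPow L B k) - pcomp (adPow L B k) L

/-- The operator `N_{k_l}^{k_r}`, where `k = (k_1, k_2, …)`: it is the identity for `l > r`, and
`N_{k_l}^{k_r} = ad_L^{k_r}(α N_{k_l}^{k_{r-1}})` for `1 ≤ l ≤ r`
(so that `N_{k_l}^{k_l} = ad_L^{k_l}(α)`). -/
def opN (L : X →ₗ.[ℂ] X) (α : X →L[ℂ] X) (k : ℕ → ℕ) (l : ℕ) : ℕ → (X →ₗ.[ℂ] X)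
  | 0 => full (ContinuousLinearMap.id ℂ X)
  | r + 1 =>
    if l ≤ r + 1 then adPow L (pcomp (full α) (opN L α k l r)) (k (r + 1))
    else full (ContinuousLinearMap.id ℂ X)

/-- `a_j^l = 1 / ∏_{r=0}^{j-1} (j-r)^{k_{l-r}+1}`. -/
def coefA (k : ℕ → ℕ) (l j : ℕ) : ℚ :=
  1 / ∏ r ∈ Finset.range j, ((j - r : ℕ) : ℚ) ^ (k (l - r) + 1)

/-- `b_j^l = 1 / (j^{k_l} ∏_{r=1}^{j-1} (j-r)^{k_{l-r}+1})` for `j ≥ 1`, and `b_0^l = 1`. -/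
def coefB (k : ℕ → ℕ) (l j : ℕ) : ℚ :=
  if j = 0 then 1
  else 1 / ((j : ℚ) ^ k l * ∏ r ∈ Finset.Ico 1 j, ((j - r : ℕ) : ℚ) ^ (k (l - r) + 1))

/-- `F_0 = Id` and `F_l = - ∑_{m=0}^{l-1} a_{l-m}^l N_{k_{m+1}}^{k_l} F_m`. -/
def opF (L : X →ₗ.[ℂ] X) (α : X →L[ℂ] X) (k : ℕ → ℕ) : ℕ → (X →ₗ.[ℂ] X)
  | 0 => full (ContinuousLinearMap.id ℂ X)
  | l + 1 =>
    -∑ m : Fin (l + 1),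
      ((coefA k (l + 1) (l + 1 - m) : ℚ) : ℂ) • pcomp (opN L α k (m + 1) (l + 1)) (opF L α k m)
  decreasing_by exact m.isLt

/-- The multi-indices `(k_1, …, k_d) ∈ ℕ^d` with `k_1 + ⋯ + k_d = q`, as sequences vanishing
outside `{1, …, d}`. -/
def multiIdx (d q : ℕ) : Finset (ℕ → ℕ) := Finset.piAntidiag (Finset.Icc 1 d) q

/-- `S` restricted to `[0, ∞)` is a strongly continuous semigroup of bounded operators. -/
structure IsC0Semigroup (S : ℝ → X →L[ℂ] X) : Prop where
  zero : S 0 = ContinuousLinearMap.id ℂ X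
  add : ∀ s t : ℝ, 0 ≤ s → 0 ≤ t → S (s + t) = (S s).comp (S t)
  cont : ∀ v : X, ContinuousOn (fun t => S t v) (Ici 0)

/-- `L`, with exactly its domain, is the infinitesimal generator of the semigroup `S`. -/
def IsGenerator (L : X →ₗ.[ℂ] X) (S : ℝ → X →L[ℂ] X) : Prop :=
  ∀ v w : X, (v, w) ∈ L.graph ↔
    Tendsto (fun h : ℝ => ((h : ℂ)⁻¹) • (S h v - v)) (𝓝[>] 0) (𝓝 w)

/-- The frequency factor `e^{i s ω t}`. -/
def osc (ω : ℝ) (s : ℕ) (t : ℝ) : ℂ := Complex.exp (Complex.I * s * ω * t)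

/-- `u` solves `u' = L u + e^{iωt} α u` on `[0, T]`, `u(0) = u₀`. -/
structure IsSolution (L : X →ₗ.[ℂ] X) (α : X →L[ℂ] X) (u₀ : X) (ω T : ℝ) (u : ℝ → X) :
    Prop where
  init : u 0 = u₀
  deriv : ∀ t ∈ Icc 0 T, ∃ h : u t ∈ L.domain,
    HasDerivWithinAt u (L ⟨u t, h⟩ + osc ω 1 t • α (u t)) (Icc 0 T) t

/-- The iterated oscillatory integral `T^d e^{tL} u₀`:
`T^0 e^{tL} u₀ = e^{tL} u₀` and
`T^{d+1} e^{tL} u₀ = ∫_0^t e^{(t-τ)L} α e^{iωτ} (T^d e^{τL} u₀) dτ`. -/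
def oscInt (S : ℝ → X →L[ℂ] X) (α : X →L[ℂ] X) (u₀ : X) (ω : ℝ) : ℕ → ℝ → X
  | 0, t => S t u₀
  | d + 1, t => ∫ τ in (0 : ℝ)..t, S (t - τ) (α (osc ω 1 τ • oscInt S α u₀ ω d τ))

/-- `S^d_n(t)`, for `d ≤ n`. -/
def serS (L : X →ₗ.[ℂ] X) (S : ℝ → X →L[ℂ] X) (α : X →L[ℂ] X) (u₀ : X) (ω : ℝ)
    (n d : ℕ) (t : ℝ) : X :=
  ∑ q ∈ Finset.range (n - d + 1), ∑ k ∈ multiIdx d q,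
    (1 / (Complex.I * ω) ^ (d + q)) • ∑ l ∈ Finset.range (d + 1),
      (((coefA k d (d - l) : ℚ) : ℂ) * osc ω (d - l) t) •
        app (opN L α k (l + 1) d) (S t (app (opF L α k l) u₀))

/-- `E^d_n(t)`, for `d ≤ n`, by recursion on `d`, with `E^0_n = 0`; in the step to `d + 1` the
multi-indices have `d + 1` entries and length `n - (d + 1) + 1 = n - d`. -/
def errE (L : X →ₗ.[ℂ] X) (S : ℝ → X →L[ℂ] X) (α : X →L[ℂ] X) (u₀ : X) (ω : ℝ)
    (n : ℕ) : ℕ → ℝ → X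
  | 0, _ => 0
  | d + 1, t =>
    (1 / (Complex.I * ω) ^ n) • (∑ k ∈ multiIdx (d + 1) (n - d), ∑ l ∈ Finset.range (d + 1),
      ((coefB k (d + 1) (d + 1 - l) : ℚ) : ℂ) • ∫ τ in (0 : ℝ)..t,
        osc ω (d + 1 - l) τ •
          S (t - τ) (app (opN L α k (l + 1) (d + 1)) (S τ (app (opF L α k l) u₀))))
    + ∫ τ in (0 : ℝ)..t, S (t - τ) (α (osc ω 1 τ • errE L S α u₀ ω n d τ))

/-- The coefficient `p_{r,s}(t)` for `r ≥ 1` (the empty multi-index `d = 0` contributes `0`). -/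
def coefP (L : X →ₗ.[ℂ] X) (S : ℝ → X →L[ℂ] X) (α : X →L[ℂ] X) (u₀ : X)
    (r s : ℕ) (t : ℝ) : X :=
  ∑ d ∈ Finset.Icc (max s 1) r, ∑ k ∈ multiIdx d (r - d),
    (((coefA k d s : ℚ) : ℂ) / Complex.I ^ r) •
      app (opN L α k (d - s + 1) d) (S t (app (opF L α k (d - s)) u₀))

/-- The remainder `R_n(t) = ∑_{d=1}^n E^d_n(t) + ∑_{d=n+1}^∞ T^d e^{tL} u₀`. -/
def remR (L : X →ₗ.[ℂ] X) (S : ℝ → X →L[ℂ] X) (α : X →L[ℂ] X) (u₀ : X) (ω : ℝ)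
    (n : ℕ) (t : ℝ) : X :=
  ∑ d ∈ Finset.Icc 1 n, errE L S α u₀ ω n d t + ∑' j : ℕ, oscInt S α u₀ ω (n + 1 + j) t

end Operators

/-! ### Function spaces on an open set `Ω ⊆ ℝᵐ` -/

section Spaces

/-- Euclidean space `ℝᵐ`. -/
abbrev E (m : ℕ) : Type := EuclideanSpace ℝ (Fin m)

variable {m : ℕ}

/-- `L^2(Ω)`, complex valued. -/
abbrev L2 (Ω : TopologicalSpace.Opens (E m)) : Type :=
  Lp ℂ 2 ((volume : Measure (E m)).restrict (Ω : Set (E m)))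

/-- `L^∞(Ω)`, complex valued. -/
abbrev LInf (Ω : TopologicalSpace.Opens (E m)) : Type :=
  Lp ℂ ∞ ((volume : Measure (E m)).restrict (Ω : Set (E m)))

/-- The order `|β| = β_1 + ⋯ + β_m`. -/
def ord (β : Fin m → ℕ) : ℕ := ∑ i, β i

/-- The classical derivative `∂^β φ = ∂_1^{β_1} ⋯ ∂_m^{β_m} φ` of a test function. -/
def testDeriv {Ω : TopologicalSpace.Opens (E m)} (β : Fin m → ℕ) (φ : 𝓓(Ω, ℂ)) : 𝓓(Ω, ℂ) :=
  (List.finRange m).foldr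
    (fun i ψ => (fun χ : 𝓓(Ω, ℂ) => ∂_{(EuclideanSpace.single i (1 : ℝ) : E m)} χ)^[β i] ψ) φ

/-- `g` is the weak derivative `∂^β f` on `Ω`. -/
def HasWeakDeriv (Ω : TopologicalSpace.Opens (E m)) (β : Fin m → ℕ) (f g : E m → ℂ) : Prop :=
  ∀ φ : 𝓓(Ω, ℂ),
    ∫ x in (Ω : Set (E m)), f x * testDeriv β φ x =
      (-1) ^ ord β * ∫ x in (Ω : Set (E m)), g x * φ x

/-- `v ∈ H^k(Ω)`. -/
def MemH (Ω : TopologicalSpace.Opens (E m)) (k : ℕ) (v : L2 Ω) : Prop :=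
  ∀ β : Fin m → ℕ, ord β ≤ k → ∃ g : L2 Ω, HasWeakDeriv Ω β v g

/-- `α ∈ W^{k,∞}(Ω)`. -/
def MemWInf (Ω : TopologicalSpace.Opens (E m)) (k : ℕ) (α : LInf Ω) : Prop :=
  ∀ β : Fin m → ℕ, ord β ≤ k → ∃ g : LInf Ω, HasWeakDeriv Ω β α g

/-- `a ∈ C_b^∞(Ω)`: smooth on `Ω`, with all derivatives bounded on `Ω`. -/
def MemCbInf (Ω : TopologicalSpace.Opens (E m)) (a : E m → ℂ) : Prop :=
  ContDiffOn ℝ ((⊤ : ℕ∞) : WithTop ℕ∞) a (Ω : Set (E m)) ∧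
    ∀ j : ℕ, ∃ M : ℝ, ∀ x ∈ Ω, ‖iteratedFDeriv ℝ j a x‖ ≤ M

/-- The multi-indices `β ∈ ℕ^m` with `|β| ≤ p`. -/
def idxLE (m p : ℕ) : Finset (Fin m → ℕ) :=
  (Finset.range (p + 1)).disjiUnion (fun j => Finset.piAntidiag Finset.univ j) <| by
    intro i _ j _ hij
    simp only [Function.onFun]
    rw [Finset.disjoint_left]
    intro β hi hj
    rw [Finset.mem_piAntidiag] at hi hj
    exact hij (hi.1.symm.trans hj.1)

/-- `D(L) ⊇ H^p(Ω)`, and `L v = ∑_{|β| ≤ p} a_β ∂^β v` for `v ∈ H^p(Ω)`. -/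
def IsDiffOp (Ω : TopologicalSpace.Opens (E m)) (p : ℕ) (a : (Fin m → ℕ) → E m → ℂ)
    (L : L2 Ω →ₗ.[ℂ] L2 Ω) : Prop :=
  ∀ (v : L2 Ω) (D : (Fin m → ℕ) → L2 Ω), (∀ β, ord β ≤ p → HasWeakDeriv Ω β v (D β)) →
    ∃ h : v ∈ L.domain,
      (L ⟨v, h⟩ : L2 Ω) =ᵐ[(volume : Measure (E m)).restrict (Ω : Set (E m))]
        fun x => ∑ β ∈ idxLE m p, a β x * D β x

/-- Multiplication by `α ∈ L^∞(Ω)`, as a bounded operator on `L^2(Ω)`. -/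
def mulOp {Ω : TopologicalSpace.Opens (E m)} (α : LInf Ω) : L2 Ω →L[ℂ] L2 Ω :=
  (ContinuousLinearMap.mul ℂ ℂ).holderL ((volume : Measure (E m)).restrict (Ω : Set (E m)))
    ∞ 2 2 α

theorem coeFn_mulOp {Ω : TopologicalSpace.Opens (E m)} (α : LInf Ω) (v : L2 Ω) :
    mulOp α v =ᵐ[(volume : Measure (E m)).restrict (Ω : Set (E m))] fun x => α x * v x :=
  (ContinuousLinearMap.mul ℂ ℂ).coeFn_holder α v

/-- `S` restricts to a strongly continuous semigroup on `H^k(Ω)`: for `v ∈ H^k(Ω)` the orbit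
`t ↦ S(t) v` is a continuous map from `[0, ∞)` to `H^k(Ω)`. -/
def IsC0OnH (Ω : TopologicalSpace.Opens (E m)) (S : ℝ → L2 Ω →L[ℂ] L2 Ω) (k : ℕ) : Prop :=
  ∀ v : L2 Ω, MemH Ω k v → ∀ β : Fin m → ℕ, ord β ≤ k →
    ∃ g : ℝ → L2 Ω, ContinuousOn g (Ici 0) ∧ ∀ t : ℝ, 0 ≤ t → HasWeakDeriv Ω β (S t v) (g t)

/-- Regularity of order `N`: the problem is well posed in `H^{jp}(Ω)` for `j ≤ N`,
`u₀ ∈ H^{Np}(Ω)` and `α ∈ W^{Np,∞}(Ω)`. -/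
structure Regular (Ω : TopologicalSpace.Opens (E m)) (p : ℕ) (S : ℝ → L2 Ω →L[ℂ] L2 Ω)
    (α : LInf Ω) (u₀ : L2 Ω) (N : ℕ) : Prop where
  wellPosed : ∀ j ≤ N, IsC0OnH Ω S (j * p)
  init : MemH Ω (N * p) u₀
  coef : MemWInf Ω (N * p) α

end Spaces

end

end ModFourier

open ModFourier

/-! By Duhamel's formula, a solution is the sum of its Dyson series `∑ T^d`. If `v` is regular
enough, then `τ ↦ e^{(t-τ)L} B e^{τL} v` has derivative `-e^{(t-τ)L} [L, B] e^{τL} v`. Each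
integration by parts against `e^{ijωτ}` with `j ≥ 1` therefore gains a factor `1/(ijω)` at the price
of one commutator with `L` (`IsScale.integral_by_parts`). No resonance occurs, because every
frequency that meets a further integral has `j ≥ 1`.

Induction on `d` gives `T^d = S^d_N + E^d_N` (`IsScale.oscInt_eq`). Under the integral defining
`T^{d+1}`, each term of `S^d_N` is integrated by parts until the power `ω^{-N}` is reached. Boundary
terms at `τ = t` carry the oscillating factors, those at `τ = 0` add up to `F_{d+1}`, and the
unfinished integrals start `E^{d+1}_N`.

The definition of `E^d_n` shows only `O(ω^{-n})`. The missing power comes from expanding the same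
`T^d` to orders `n` and `n + 1`: `E^d_n` equals the terms of order `n + 1` plus `E^d_{n+1}`.
Likewise `T^{n+1} = O(ω^{-(n+1)})`, and the Volterra bound `(K‖α‖t)^j / j!` carries this to every
`T^{n+1+j}` without further regularity (`IsScale.unifBigO_remR`).

Domains are controlled in an abstract scale (`IsScale`) in which `L` costs one unit and `α` none, so
that an operator with multi-index `k` costs `|k|` units; the closed graph theorem supplies all
bounds. For the spaces `H^{jp}(Ω)` the main point is the Leibniz rule for `W^{1,∞}` times `L²` on an
arbitrary open set (`HasWeakDeriv.mul_of_bound`), proved by mollifying the bounded factor. -/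

namespace ModFourier

/-! ### Strongly continuous semigroups, their generators, Duhamel's formula -/

section Semigroup

variable {X : Type*} [NormedAddCommGroup X] [NormedSpace ℂ X]

theorem app_of_mem {A : X →ₗ.[ℂ] X} {v : X} (h : v ∈ A.domain) : app A v = A ⟨v, h⟩ :=
  dif_pos h

theorem IsC0Semigroup.exists_bound [CompleteSpace X] {S : ℝ → X →L[ℂ] X} (hS : IsC0Semigroup S)
    (T : ℝ) : ∃ K : ℝ, 1 ≤ K ∧ ∀ t ∈ Icc 0 T, ‖S t‖ ≤ K := by
  have h : ∀ v, ∃ C, ∀ t : Icc (0 : ℝ) T, ‖S t v‖ ≤ C := by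
    intro v
    have hc : ContinuousOn (fun t => S t v) (Icc 0 T) :=
      (hS.cont v).mono Icc_subset_Ici_self
    obtain ⟨C, hC⟩ := isCompact_Icc.exists_bound_of_continuousOn hc
    exact ⟨C, fun t => hC t t.2⟩
  obtain ⟨C, hC⟩ := banach_steinhaus (g := fun t : Icc (0 : ℝ) T => S t) h
  exact ⟨max C 1, le_max_right _ _, fun t ht => (hC ⟨t, ht⟩).trans (le_max_left _ _)⟩

/-- Joint strong continuity of a semigroup, extended by the identity to negative times. -/
theorem IsC0Semigroup.continuous_uncurry [CompleteSpace X] {S : ℝ → X →L[ℂ] X}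
    (hS : IsC0Semigroup S) : Continuous fun q : ℝ × X => S (max q.1 0) q.2 := by
  rw [continuous_iff_continuousAt]
  rintro ⟨t, v⟩
  obtain ⟨K, hK1, hK⟩ := hS.exists_bound (max (t + 1) 0)
  have hcv : Continuous fun s : ℝ => S (max s 0) v :=
    (hS.cont v).comp_continuous (by fun_prop) fun s => mem_Ici.2 (le_max_right _ _)
  have hlim : Tendsto (fun q : ℝ × X => K * ‖q.2 - v‖ + ‖S (max q.1 0) v - S (max t 0) v‖)
      (𝓝 (t, v)) (𝓝 0) := by
    have : Continuous fun q : ℝ × X =>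
        K * ‖q.2 - v‖ + ‖S (max q.1 0) v - S (max t 0) v‖ := by
      have := hcv.comp (continuous_fst (X := ℝ) (Y := X))
      exact (continuous_const.mul (continuous_snd.sub continuous_const).norm).add
        (this.sub continuous_const).norm
    simpa using this.tendsto (t, v)
  rw [ContinuousAt, tendsto_iff_norm_sub_tendsto_zero]
  refine squeeze_zero' (Eventually.of_forall fun _ => norm_nonneg _) ?_ hlim
  have hnear : ∀ᶠ q : ℝ × X in 𝓝 (t, v), q.1 < t + 1 :=
    (continuous_fst.tendsto (t, v)).eventually (gt_mem_nhds (by simp))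
  filter_upwards [hnear] with q hq
  have h1 : S (max q.1 0) q.2 - S (max t 0) v
      = S (max q.1 0) (q.2 - v) + (S (max q.1 0) v - S (max t 0) v) := by
    rw [map_sub]; abel
  rw [h1]
  refine (norm_add_le _ _).trans (add_le_add_left ?_ _)
  exact (S (max q.1 0)).le_of_opNorm_le
    (hK _ ⟨le_max_right _ _, max_le_max hq.le le_rfl⟩) _

theorem IsC0Semigroup.continuousOn_apply [CompleteSpace X] {S : ℝ → X →L[ℂ] X}
    (hS : IsC0Semigroup S) {Y : Type*} [TopologicalSpace Y] {s : Set Y} {r : Y → ℝ} {f : Y → X}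
    (hr : ContinuousOn r s) (hr0 : ∀ y ∈ s, 0 ≤ r y) (hf : ContinuousOn f s) :
    ContinuousOn (fun y => S (r y) (f y)) s := by
  refine (hS.continuous_uncurry.comp_continuousOn (hr.prodMk hf)).congr fun y hy => ?_
  simp [max_eq_left (hr0 y hy)]

theorem IsC0Semigroup.continuousOn_convolution_integrand [CompleteSpace X] {S : ℝ → X →L[ℂ] X}
    (hS : IsC0Semigroup S) {T t : ℝ} (ht : t ∈ Icc 0 T) {f : ℝ → X}
    (hf : ContinuousOn f (Icc 0 T)) : ContinuousOn (fun τ => S (t - τ) (f τ)) (Icc 0 t) :=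
  hS.continuousOn_apply (by fun_prop) (fun τ hτ => sub_nonneg.2 hτ.2)
    (hf.mono (Icc_subset_Icc_right ht.2))

theorem IsC0Semigroup.intervalIntegrable_convolution [CompleteSpace X] {S : ℝ → X →L[ℂ] X}
    (hS : IsC0Semigroup S) {T t : ℝ} (ht : t ∈ Icc 0 T) {f : ℝ → X}
    (hf : ContinuousOn f (Icc 0 T)) :
    IntervalIntegrable (fun τ => S (t - τ) (f τ)) volume 0 t :=
  ContinuousOn.intervalIntegrable_of_Icc ht.1 (hS.continuousOn_convolution_integrand ht hf)

theorem IsC0Semigroup.continuousOn_convolution [CompleteSpace X] {S : ℝ → X →L[ℂ] X}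
    (hS : IsC0Semigroup S) {T : ℝ} (hT : 0 ≤ T) {f : ℝ → X} (hf : ContinuousOn f (Icc 0 T)) :
    ContinuousOn (fun t => ∫ τ in (0 : ℝ)..t, S (t - τ) (f τ)) (Icc 0 T) := by
  have hf' : Continuous (IccExtend hT ((Icc 0 T).domRestrict f)) :=
    (continuousOn_iff_continuous_domRestrict.1 hf).Icc_extend'
  have hG : Continuous (Function.uncurry fun t τ : ℝ =>
      S (max (t - τ) 0) (IccExtend hT ((Icc 0 T).domRestrict f) τ)) := by
    have h2 : Continuous fun q : ℝ × ℝ =>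
        ((q.1 - q.2, IccExtend hT ((Icc 0 T).domRestrict f) q.2) : ℝ × X) :=
      (continuous_fst.sub continuous_snd).prodMk (hf'.comp continuous_snd)
    exact hS.continuous_uncurry.comp h2
  have := intervalIntegral.continuous_parametric_intervalIntegral_of_continuous (μ := volume)
    (a₀ := (0 : ℝ)) hG continuous_id
  refine this.continuousOn.congr fun t ht => ?_
  refine intervalIntegral.integral_congr fun τ hτ => ?_
  rw [uIcc_of_le ht.1] at hτ
  simp only [IccExtend_of_mem hT _ ⟨hτ.1, hτ.2.trans ht.2⟩, Set.domRestrict_apply,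
    max_eq_left (sub_nonneg.2 hτ.2)]

variable {S : ℝ → X →L[ℂ] X} {L : X →ₗ.[ℂ] X}

theorem IsGenerator.tendsto (hLS : IsGenerator L S) {v : X} (hv : v ∈ L.domain) :
    Tendsto (fun h : ℝ => ((h : ℂ)⁻¹) • (S h v - v)) (𝓝[>] 0) (𝓝 (L ⟨v, hv⟩)) :=
  (hLS v _).1 (L.mem_graph ⟨v, hv⟩)

theorem IsGenerator.of_tendsto (hLS : IsGenerator L S) {v w : X}
    (h : Tendsto (fun h : ℝ => ((h : ℂ)⁻¹) • (S h v - v)) (𝓝[>] 0) (𝓝 w)) :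
    ∃ hv : v ∈ L.domain, L ⟨v, hv⟩ = w := by
  have := (hLS v w).2 h
  rw [LinearPMap.mem_graph_iff] at this
  obtain ⟨y, hy, hw⟩ := this
  subst hy
  exact ⟨y.2, hw⟩

/-- `S t` commutes with the difference quotients at time zero, so it may be applied to their limit.
-/
theorem IsGenerator.map_semigroup (hS : IsC0Semigroup S) (hLS : IsGenerator L S) {v : X}
    (hv : v ∈ L.domain) {t : ℝ} (ht : 0 ≤ t) :
    ∃ h : S t v ∈ L.domain, L ⟨S t v, h⟩ = S t (L ⟨v, hv⟩) := by
  refine hLS.of_tendsto ?_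
  have := ((S t).continuous.tendsto _).comp (hLS.tendsto hv)
  refine this.congr' ?_
  filter_upwards [self_mem_nhdsWithin] with h hh
  have hh' : (0 : ℝ) ≤ h := le_of_lt hh
  simp only [Function.comp_apply, map_smul, map_sub]
  rw [← ContinuousLinearMap.comp_apply, ← hS.add t h ht hh', add_comm, hS.add h t hh' ht]
  rfl

theorem IsGenerator.hasDerivWithinAt_Ioi (hS : IsC0Semigroup S) (hLS : IsGenerator L S) {v : X}
    (hv : v ∈ L.domain) {t : ℝ} (ht : 0 ≤ t) :
    HasDerivWithinAt (fun s => S s v) (S t (L ⟨v, hv⟩)) (Ioi t) t := by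
  rw [hasDerivWithinAt_iff_tendsto_slope' (by simp)]
  obtain ⟨h, hL⟩ := hLS.map_semigroup hS hv ht
  have h1 := hLS.tendsto h
  rw [hL] at h1
  have h2 : Tendsto (fun s : ℝ => s - t) (𝓝[>] t) (𝓝[>] 0) := by
    refine tendsto_nhdsWithin_iff.2 ⟨?_, ?_⟩
    · refine Tendsto.mono_left ?_ nhdsWithin_le_nhds
      have : Continuous fun s : ℝ => s - t := by fun_prop
      simpa using this.tendsto t
    · filter_upwards [self_mem_nhdsWithin] with s hs using mem_Ioi.2 (sub_pos.2 (mem_Ioi.1 hs))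
  refine (h1.comp h2).congr' ?_
  filter_upwards [self_mem_nhdsWithin] with s hs
  have hs' : 0 ≤ s - t := le_of_lt (sub_pos.2 (mem_Ioi.1 hs))
  simp only [Function.comp_apply, slope_def_module]
  rw [← ContinuousLinearMap.comp_apply, ← hS.add _ _ hs' ht, sub_add_cancel]
  rw [← Complex.ofReal_inv, Complex.coe_smul]

/-- The generator gives only a right derivative of the orbit; for a continuous function with
integrable right derivative the fundamental theorem of calculus still holds. -/
theorem IsGenerator.sub_eq_integral [CompleteSpace X] (hS : IsC0Semigroup S)
    (hLS : IsGenerator L S) {v : X} (hv : v ∈ L.domain) {t : ℝ} (ht : 0 ≤ t) :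
    S t v - v = ∫ s in (0 : ℝ)..t, S s (L ⟨v, hv⟩) := by
  have hc : ContinuousOn (fun s => S s (L ⟨v, hv⟩)) (Icc 0 t) :=
    (hS.cont _).mono Icc_subset_Ici_self
  rw [intervalIntegral.integral_eq_sub_of_hasDeriv_right (f := fun s => S s v)]
  · simp [hS.zero]
  · rw [uIcc_of_le ht]
    exact (hS.cont v).mono Icc_subset_Ici_self
  · intro s hs
    rw [min_eq_left ht] at hs
    exact hLS.hasDerivWithinAt_Ioi hS hv hs.1.le
  · exact ContinuousOn.intervalIntegrable_of_Icc ht hc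

/-- Turns an integrated equation into a derivative, in any Banach space, since it is needed in `X`
and in the spaces of the scale. Freezing `w` at `w 0` for negative times makes the two-sided theorem
applicable at `t = 0`. -/
theorem hasDerivWithinAt_Ici_of_sub_eq_integral {Y : Type*} [NormedAddCommGroup Y]
    [NormedSpace ℝ Y] [CompleteSpace Y] {g w : ℝ → Y} (hw : ContinuousOn w (Ici 0))
    (h : ∀ t, 0 ≤ t → g t - g 0 = ∫ s in (0 : ℝ)..t, w s) {t : ℝ} (ht : 0 ≤ t) :
    HasDerivWithinAt g (w t) (Ici 0) t := by
  have hW : Continuous fun s : ℝ => w (max s 0) :=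
    hw.comp_continuous (by fun_prop) fun s => mem_Ici.2 (le_max_right _ _)
  have h1 : HasDerivAt (fun t : ℝ => g 0 + ∫ s in (0 : ℝ)..t, w (max s 0)) (w (max t 0)) t :=
    (intervalIntegral.integral_hasDerivAt_right (hW.intervalIntegrable _ _)
      (hW.stronglyMeasurableAtFilter _ _) hW.continuousAt).const_add _
  rw [max_eq_left ht] at h1
  refine h1.hasDerivWithinAt.congr_of_mem (fun s hs => ?_) ht
  rw [← sub_eq_iff_eq_add', h s hs]
  refine intervalIntegral.integral_congr fun τ hτ => ?_
  rw [uIcc_of_le hs] at hτ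
  simp [max_eq_left hτ.1]

theorem IsGenerator.hasDerivWithinAt [CompleteSpace X] (hS : IsC0Semigroup S)
    (hLS : IsGenerator L S) {v : X} (hv : v ∈ L.domain) {t : ℝ} (ht : 0 ≤ t) :
    HasDerivWithinAt (fun s => S s v) (S t (L ⟨v, hv⟩)) (Ici 0) t :=
  hasDerivWithinAt_Ici_of_sub_eq_integral (w := fun t => S t (L ⟨v, hv⟩)) (hS.cont _)
    (fun s hs => by simpa [hS.zero] using hLS.sub_eq_integral hS hv hs) ht

/-- The generator of a strongly continuous semigroup is closed. -/
theorem IsGenerator.closed [CompleteSpace X] (hS : IsC0Semigroup S) (hLS : IsGenerator L S)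
    {v : ℕ → X} (hv : ∀ i, v i ∈ L.domain) {x y : X} (hx : Tendsto v atTop (𝓝 x))
    (hy : Tendsto (fun i => L ⟨v i, hv i⟩) atTop (𝓝 y)) :
    ∃ h : x ∈ L.domain, L ⟨x, h⟩ = y := by
  -- The integrated equation survives the limit by dominated convergence; its right derivative at
  -- zero then identifies `y`.
  have hint : ∀ t, 0 ≤ t → S t x - x = ∫ s in (0 : ℝ)..t, S s y := by
    intro t ht
    obtain ⟨K, hK1, hK⟩ := hS.exists_bound t
    have h1 : Tendsto (fun i => S t (v i) - v i) atTop (𝓝 (S t x - x)) :=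
      (((S t).continuous.tendsto x).comp hx).sub hx
    refine tendsto_nhds_unique h1 ?_
    simp_rw [hLS.sub_eq_integral hS (hv _) ht]
    obtain ⟨C, hC⟩ := (hy.norm.bddAbove_range)
    refine intervalIntegral.tendsto_integral_filter_of_dominated_convergence (fun _ => K * C)
      (Eventually.of_forall fun i => ?_) (Eventually.of_forall fun i => ?_) (by simp) ?_
    · refine ContinuousOn.aestronglyMeasurable ?_ measurableSet_uIoc
      refine (hS.cont _).mono ?_
      rw [uIoc_of_le ht]
      exact fun s hs => hs.1.le
    · refine Eventually.of_forall fun s hs => ?_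
      rw [uIoc_of_le ht] at hs
      refine ((S s).le_of_opNorm_le (hK s ⟨hs.1.le, hs.2⟩) _).trans ?_
      have := hC (mem_range_self i)
      gcongr
    · exact Eventually.of_forall fun s _ => ((S s).continuous.tendsto y).comp hy
  have hd := hasDerivWithinAt_Ici_of_sub_eq_integral (g := fun t => S t x)
    (w := fun t => S t y) (hS.cont _) (fun s hs => by simpa [hS.zero] using hint s hs) le_rfl
  refine hLS.of_tendsto ?_
  have := (hasDerivWithinAt_iff_tendsto_slope' (by simp)).1 (hd.mono Ioi_subset_Ici_self)
  rw [hS.zero] at this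
  refine this.congr' ?_
  filter_upwards with s
  simp only [slope_def_module, sub_zero, hS.zero, ContinuousLinearMap.id_apply]
  rw [← Complex.ofReal_inv, Complex.coe_smul]

/-- Variation of constants: a classical solution `g` of `g' = L g + r` is given by Duhamel's
formula. -/
theorem IsGenerator.variation_of_constants [CompleteSpace X] (hS : IsC0Semigroup S)
    (hLS : IsGenerator L S) {T : ℝ} {g r : ℝ → X} (hr : ContinuousOn r (Icc 0 T))
    (hg : ∀ τ ∈ Icc 0 T, ∃ h : g τ ∈ L.domain,
      HasDerivWithinAt g (L ⟨g τ, h⟩ + r τ) (Icc 0 T) τ) {t : ℝ} (ht : t ∈ Icc 0 T) :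
    g t = S t (g 0) + ∫ τ in (0 : ℝ)..t, S (t - τ) (r τ) := by
  have hgc : ContinuousOn g (Icc 0 T) := fun τ hτ => (hg τ hτ).choose_spec.continuousWithinAt
  rw [← sub_eq_iff_eq_add']
  -- The right derivative of `τ ↦ S (t - τ) (g τ)` is `S (t - τ) (r τ)`, because the two
  -- contributions of `L` cancel.
  rw [intervalIntegral.integral_eq_sub_of_hasDeriv_right (f := fun τ => S (t - τ) (g τ))]
  · simp [hS.zero]
  · rw [uIcc_of_le ht.1]
    exact hS.continuousOn_convolution_integrand ht hgc
  · intro τ hτ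
    rw [min_eq_left ht.1, max_eq_right ht.1] at hτ
    obtain ⟨h, hd⟩ := hg τ ⟨hτ.1.le, hτ.2.le.trans ht.2⟩
    have hd1 : HasDerivWithinAt g (L ⟨g τ, h⟩ + r τ) (Ioi τ) τ :=
      hd.mono_of_mem_nhdsWithin (mem_nhdsWithin_of_mem_nhds
        (Icc_mem_nhds hτ.1 (hτ.2.trans_le ht.2)))
    have hd2 : HasDerivAt (fun σ => S (t - σ) (g τ)) (-(S (t - τ) (L ⟨g τ, h⟩))) τ := by
      have h1 := (hLS.hasDerivWithinAt hS h (sub_nonneg.2 hτ.2.le)).hasDerivAt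
        (Ici_mem_nhds (sub_pos.2 hτ.2))
      have h2 : HasDerivAt (fun σ : ℝ => t - σ) (-1) τ := by
        simpa using (hasDerivAt_id τ).const_sub t
      simpa [Function.comp_def] using h1.scomp τ h2
    rw [hasDerivWithinAt_iff_tendsto_slope' (by simp)] at hd1 ⊢
    have hs2 := (hasDerivWithinAt_iff_tendsto_slope' (by simp)).1
      (hd2.hasDerivWithinAt (s := Ioi τ))
    have hlt : ∀ᶠ σ in 𝓝[>] τ, σ < t := nhdsWithin_le_nhds (gt_mem_nhds hτ.2)
    -- The product rule is done on slopes: without norm continuity of `S`, joint strong continuity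
    -- is what passes to the limit in `S (t - σ)` applied to the slope of `g`.
    have hs1 : Tendsto (fun σ => S (t - σ) (slope g τ σ)) (𝓝[>] τ)
        (𝓝 (S (t - τ) (L ⟨g τ, h⟩ + r τ))) := by
      have h3 : Tendsto (fun σ => ((t - σ, slope g τ σ) : ℝ × X)) (𝓝[>] τ)
          (𝓝 (t - τ, L ⟨g τ, h⟩ + r τ)) := by
        refine Tendsto.prodMk_nhds ?_ hd1
        have : Continuous fun σ : ℝ => t - σ := by fun_prop
        exact (this.tendsto τ).mono_left nhdsWithin_le_nhds
      have h4 := (hS.continuous_uncurry.tendsto _).comp h3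
      simp only [max_eq_left (sub_nonneg.2 hτ.2.le)] at h4
      refine h4.congr' ?_
      filter_upwards [hlt] with σ hσ
      simp [max_eq_left (sub_nonneg.2 hσ.le)]
    have := hs1.add hs2
    rw [map_add, add_comm, neg_add_cancel_left] at this
    refine this.congr' (Eventually.of_forall fun σ => ?_)
    simp only [slope_def_module]
    rw [show ∀ (c : ℝ) (x : X), S (t - σ) (c • x) = c • S (t - σ) x from
      fun c x => (S (t - σ)).map_smul_of_tower c x, ← smul_add, map_sub]
    congr 1
    abel
  · exact hS.intervalIntegrable_convolution ht hr

end Semigroup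

/-! ### Calculus of unbounded operators through their graphs -/

section Sends

variable {X : Type*} [NormedAddCommGroup X] [NormedSpace ℂ X]

/-- `v ∈ D(B)` and `B v = w`. -/
def Sends (B : X →ₗ.[ℂ] X) (v w : X) : Prop := ∃ h : v ∈ B.domain, B ⟨v, h⟩ = w

variable {A B : X →ₗ.[ℂ] X} {v w z : X}

theorem Sends.app_eq (h : Sends B v w) : app B v = w := by
  obtain ⟨hv, rfl⟩ := h
  exact app_of_mem hv

theorem Sends.mem (h : Sends B v w) : v ∈ B.domain := h.1

theorem sends_app (h : v ∈ B.domain) : Sends B v (app B v) := ⟨h, (app_of_mem h).symm⟩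

theorem Sends.pcomp (hB : Sends B v w) (hA : Sends A w z) : Sends (pcomp A B) v z := by
  obtain ⟨hv, rfl⟩ := hB
  obtain ⟨hw, rfl⟩ := hA
  exact ⟨⟨hv, hw⟩, rfl⟩

theorem Sends.sub (hA : Sends A v w) (hB : Sends B v z) : Sends (A - B) v (w - z) := by
  obtain ⟨hv, rfl⟩ := hA
  obtain ⟨hw, rfl⟩ := hB
  exact ⟨⟨hv, hw⟩, rfl⟩

theorem Sends.add (hA : Sends A v w) (hB : Sends B v z) : Sends (A + B) v (w + z) := by
  obtain ⟨hv, rfl⟩ := hA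
  obtain ⟨hw, rfl⟩ := hB
  exact ⟨⟨hv, hw⟩, rfl⟩

theorem Sends.neg (hA : Sends A v w) : Sends (-A) v (-w) := by
  obtain ⟨hv, rfl⟩ := hA
  exact ⟨hv, rfl⟩

theorem Sends.smul (c : ℂ) (hA : Sends A v w) : Sends (c • A) v (c • w) := by
  obtain ⟨hv, rfl⟩ := hA
  exact ⟨hv, rfl⟩

theorem Sends.map_smul (c : ℂ) (hA : Sends A v w) : Sends A (c • v) (c • w) := by
  obtain ⟨hv, rfl⟩ := hA
  exact ⟨A.domain.smul_mem c hv, A.map_smul c ⟨v, hv⟩⟩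

theorem Sends.map_add {v' w' : X} (h : Sends A v w) (h' : Sends A v' w') :
    Sends A (v + v') (w + w') := by
  obtain ⟨hv, rfl⟩ := h
  obtain ⟨hv', rfl⟩ := h'
  exact ⟨A.domain.add_mem hv hv', A.map_add ⟨v, hv⟩ ⟨v', hv'⟩⟩

theorem Sends.unique (h : Sends A v w) (h' : Sends A v z) : w = z := h.app_eq.symm.trans h'.app_eq

theorem sends_full (C : X →L[ℂ] X) (v : X) : Sends (full C) v (C v) := ⟨trivial, rfl⟩

theorem Sends.sum {κ : Type*} {s : Finset κ} {A : κ → X →ₗ.[ℂ] X} {w : κ → X}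
    (h : ∀ i ∈ s, Sends (A i) v (w i)) : Sends (∑ i ∈ s, A i) v (∑ i ∈ s, w i) := by
  classical
  induction s using Finset.induction_on with
  | empty => exact ⟨trivial, rfl⟩
  | insert i s hi ih =>
    rw [Finset.sum_insert hi, Finset.sum_insert hi]
    exact (h i (s.mem_insert_self i)).add (ih fun j hj => h j (Finset.mem_insert_of_mem hj))

end Sends

/-! ### Scales of Banach spaces and integration by parts -/

section Scale

variable {X : Type*} [NormedAddCommGroup X] [NormedSpace ℂ X]
  {H : ℕ → Type*} [∀ j, NormedAddCommGroup (H j)] [∀ j, NormedSpace ℂ (H j)]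

/-- A scale of Banach spaces `H 0, …, H M`, continuously embedded in `X`, on which `L` acts as an
operator of order one and `α` as an operator of order zero, and in which the orbits of `S` are
continuous. -/
structure IsScale (L : X →ₗ.[ℂ] X) (S : ℝ → X →L[ℂ] X) (α : X →L[ℂ] X)
    (ι : ∀ j, H j →L[ℂ] X) (M : ℕ) : Prop where
  injective : ∀ j, Function.Injective (ι j)
  antitone : ∀ i j, i ≤ j → range (ι j) ⊆ range (ι i)
  gen : ∀ j, j + 1 ≤ M → ∀ v ∈ range (ι (j + 1)), ∃ w ∈ range (ι j), Sends L v w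
  mul : ∀ j ≤ M, ∀ v ∈ range (ι j), α v ∈ range (ι j)
  orbit : ∀ j ≤ M, ∀ v ∈ range (ι j), ∃ g : ℝ → H j, ContinuousOn g (Ici 0) ∧
    ∀ t, 0 ≤ t → ι j (g t) = S t v

/-- `B` maps `H (q + j)` continuously to `H j` whenever `q + j ≤ M`. -/
def HasOrder (ι : ∀ j, H j →L[ℂ] X) (M : ℕ) (B : X →ₗ.[ℂ] X) (q : ℕ) : Prop :=
  ∀ i j, i = q + j → i ≤ M → ∃ C : H i →L[ℂ] H j, ∀ v, Sends B (ι i v) (ι j (C v))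

variable {L : X →ₗ.[ℂ] X} {S : ℝ → X →L[ℂ] X} {α : X →L[ℂ] X} {ι : ∀ j, H j →L[ℂ] X} {M : ℕ}
  {A B : X →ₗ.[ℂ] X} {q q' : ℕ}

theorem HasOrder.pcomp (hA : HasOrder ι M A q) (hB : HasOrder ι M B q') :
    HasOrder ι M (pcomp A B) (q + q') := by
  intro i j hij hi
  obtain ⟨C, hC⟩ := hB i (q + j) (by omega) hi
  obtain ⟨D, hD⟩ := hA (q + j) j rfl (by omega)
  exact ⟨D.comp C, fun v => (hC v).pcomp (hD _)⟩

theorem HasOrder.sub (hA : HasOrder ι M A q) (hB : HasOrder ι M B q) :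
    HasOrder ι M (A - B) q := by
  intro i j hij hi
  obtain ⟨C, hC⟩ := hA i j hij hi
  obtain ⟨D, hD⟩ := hB i j hij hi
  exact ⟨C - D, fun v => by simpa using (hC v).sub (hD v)⟩

theorem HasOrder.neg (hA : HasOrder ι M A q) : HasOrder ι M (-A) q := by
  intro i j hij hi
  obtain ⟨C, hC⟩ := hA i j hij hi
  exact ⟨-C, fun v => by simpa using (hC v).neg⟩

theorem HasOrder.smul (c : ℂ) (hA : HasOrder ι M A q) : HasOrder ι M (c • A) q := by
  intro i j hij hi
  obtain ⟨C, hC⟩ := hA i j hij hi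
  exact ⟨c • C, fun v => by simpa using (hC v).smul c⟩

theorem HasOrder.sum {κ : Type*} {s : Finset κ} {A : κ → X →ₗ.[ℂ] X}
    (h : ∀ i ∈ s, HasOrder ι M (A i) q) : HasOrder ι M (∑ i ∈ s, A i) q := by
  intro i j hij hi
  choose! C hC using fun k (hk : k ∈ s) => h k hk i j hij hi
  refine ⟨∑ k ∈ s, C k, fun v => ?_⟩
  simp only [sum_apply, map_sum]
  exact Sends.sum fun k hk => hC k hk v

theorem hasOrder_full_id : HasOrder ι M (full (ContinuousLinearMap.id ℂ X)) 0 := by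
  intro i j hij _
  obtain rfl : i = j := by omega
  exact ⟨ContinuousLinearMap.id ℂ _, fun v => sends_full _ _⟩

/-- Closed graph theorem: a closed operator of `X` that maps the range of one embedding into the
range of another one lifts to a bounded operator. -/
theorem exists_lift_of_closed {Y Z : Type*} [NormedAddCommGroup Y] [NormedSpace ℂ Y]
    [CompleteSpace Y] [NormedAddCommGroup Z] [NormedSpace ℂ Z] [CompleteSpace Z]
    {e : Y →L[ℂ] X} {f : Z →L[ℂ] X} (hf : Function.Injective f)
    (hB : ∀ (v : ℕ → X) (w : ℕ → X) (x y : X), (∀ i, Sends B (v i) (w i)) →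
      Tendsto v atTop (𝓝 x) → Tendsto w atTop (𝓝 y) → Sends B x y)
    (hm : ∀ v, ∃ z, Sends B (e v) (f z)) :
    ∃ C : Y →L[ℂ] Z, ∀ v, Sends B (e v) (f (C v)) := by
  -- Injectivity of `f` makes the chosen preimages unique, hence linear, and transfers closedness of
  -- `B` to the graph of `C`.
  choose C hC using hm
  have hadd : ∀ u v, C (u + v) = C u + C v := by
    intro u v
    apply hf
    have := (hC u).map_add (hC v)
    rw [← map_add, ← map_add] at this
    exact (hC (u + v)).unique this
  have hsmul : ∀ (c : ℂ) v, C (c • v) = c • C v := by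
    intro c v
    apply hf
    have := (hC v).map_smul c
    rw [← map_smul, ← map_smul] at this
    exact (hC (c • v)).unique this
  let Cl : Y →ₗ[ℂ] Z := { toFun := C, map_add' := hadd, map_smul' := hsmul }
  refine ⟨⟨Cl, Cl.continuous_of_seq_closed_graph fun u x y hu hCu => ?_⟩, hC⟩
  apply hf
  exact (hB (fun i => e (u i)) (fun i => f (C (u i))) (e x) (f y) (fun i => hC _)
    ((e.continuous.tendsto x).comp hu) ((f.continuous.tendsto y).comp hCu)).unique (hC x)

/-- Each commutator with `L` is charged one full unit; the possible cancellation of leading parts is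
not exploited. -/
theorem HasOrder.adPow (hL : HasOrder ι M L 1) (hB : HasOrder ι M B q) (k : ℕ) :
    HasOrder ι M (adPow L B k) (q + k) := by
  induction k with
  | zero => exact hB
  | succ k ih =>
    have h1 := hL.pcomp ih
    have h2 := ih.pcomp hL
    rw [add_comm 1] at h1
    exact h1.sub h2

theorem HasOrder.opN (hL : HasOrder ι M L 1) (hα : HasOrder ι M (full α) 0) (k : ℕ → ℕ)
    {l : ℕ} (hl : 1 ≤ l) (r : ℕ) : HasOrder ι M (opN L α k l r) (∑ i ∈ Finset.Icc l r, k i) := by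
  induction r with
  | zero =>
    rw [Finset.Icc_eq_empty (by omega)]
    exact hasOrder_full_id
  | succ r ih =>
    rw [ModFourier.opN]
    split_ifs with hlr
    · have := hL.adPow (hα.pcomp ih) (k (r + 1))
      rwa [zero_add, ← Finset.sum_Icc_succ_top hlr] at this
    · rw [Finset.Icc_eq_empty (by omega)]
      exact hasOrder_full_id

theorem HasOrder.opF (hL : HasOrder ι M L 1) (hα : HasOrder ι M (full α) 0) (k : ℕ → ℕ)
    (l : ℕ) : HasOrder ι M (opF L α k l) (∑ i ∈ Finset.Icc 1 l, k i) := by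
  induction l using Nat.strong_induction_on with
  | _ l ih =>
    cases l with
    | zero =>
      rw [ModFourier.opF, Finset.Icc_eq_empty (by omega)]
      exact hasOrder_full_id
    | succ l =>
      rw [ModFourier.opF]
      refine (HasOrder.sum fun m _ => HasOrder.smul _ ?_).neg
      have := (hL.opN hα k (Nat.le_add_left 1 m) (l + 1)).pcomp (ih m m.isLt)
      convert this using 1
      -- `F_m` costs `k_1 + ⋯ + k_m` and `N_{k_{m+1}}^{k_{l+1}}` costs the rest, so all summands
      -- have the same order.
      refine Eq.trans ?_ (add_comm _ _)
      have hIcc : ∀ a b : ℕ, Finset.Icc (a + 1) b = Finset.Ioc a b := fun a b => by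
        ext; simp
      simp only [hIcc]
      exact (Finset.sum_Ioc_consecutive k (Nat.zero_le _) m.isLt.le).symm

theorem HasOrder.sends (hB : HasOrder ι M B q) {i j : ℕ} (hij : i = q + j) (hi : i ≤ M) {v : X}
    (hv : v ∈ range (ι i)) : v ∈ B.domain ∧ app B v ∈ range (ι j) := by
  obtain ⟨C, hC⟩ := hB i j hij hi
  obtain ⟨v, rfl⟩ := hv
  exact ⟨(hC v).mem, by rw [(hC v).app_eq]; exact mem_range_self _⟩

theorem IsScale.semigroup_mem (h : IsScale L S α ι M) {i : ℕ} (hi : i ≤ M) {v : X}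
    (hv : v ∈ range (ι i)) {t : ℝ} (ht : 0 ≤ t) : S t v ∈ range (ι i) := by
  obtain ⟨g, -, hg⟩ := h.orbit i hi v hv
  exact ⟨g t, hg t ht⟩

theorem IsScale.continuousOn_app (h : IsScale L S α ι M) (hB : HasOrder ι M B q) (hq : q ≤ M)
    {v : X} (hv : v ∈ range (ι q)) : ContinuousOn (fun t => app B (S t v)) (Ici 0) := by
  obtain ⟨g, hgc, hg⟩ := h.orbit q hq v hv
  obtain ⟨C, hC⟩ := hB q 0 rfl hq
  have : ContinuousOn (fun t => ι 0 (C (g t))) (Ici 0) :=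
    (ι 0).continuous.comp_continuousOn (C.continuous.comp_continuousOn hgc)
  refine this.congr fun t ht => ?_
  rw [← hg t ht]
  exact (hC _).app_eq

/-- Only invariance of the ranges under `α` is assumed; boundedness on each space comes from the
closed graph theorem. -/
theorem IsScale.hasOrder_mul [∀ j, CompleteSpace (H j)] (h : IsScale L S α ι M) :
    HasOrder ι M (full α) 0 := by
  intro i j hij hi
  obtain rfl : i = j := by omega
  refine exists_lift_of_closed (h.injective i) (fun v w x y hvw hv hw => ?_) fun v => ?_
  · refine ⟨trivial, tendsto_nhds_unique ((α.continuous.tendsto x).comp hv) (hw.congr fun i => ?_)⟩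
    obtain ⟨_, hi⟩ := hvw i
    exact hi.symm
  · obtain ⟨z, hz⟩ := h.mul i hi _ (mem_range_self v)
    exact ⟨z, by rw [hz]; exact sends_full _ _⟩

variable [CompleteSpace X] [∀ j, CompleteSpace (H j)]

/-- The closed graph theorem applies because a generator is closed. -/
theorem IsScale.hasOrder_gen (h : IsScale L S α ι M) (hS : IsC0Semigroup S)
    (hLS : IsGenerator L S) : HasOrder ι M L 1 := by
  intro i j hij hi
  obtain rfl : i = j + 1 := by omega
  refine exists_lift_of_closed (h.injective j) (fun v w x y hvw hv hw => ?_) fun v => ?_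
  · choose hd he using hvw
    exact hLS.closed hS hd hv (by simpa only [he] using hw)
  · obtain ⟨_, ⟨z, rfl⟩, hz⟩ := h.gen j hi _ (mem_range_self v)
    exact ⟨z, hz⟩

/-- With one spare unit of regularity the orbit is differentiable in `H q` itself, with derivative
the orbit of `L v`, and `B` acts there as a bounded operator. -/
theorem IsScale.hasDerivWithinAt_app (h : IsScale L S α ι M) (hS : IsC0Semigroup S)
    (hLS : IsGenerator L S) (hB : HasOrder ι M B q) (hq : q + 1 ≤ M)
    {v : X} (hv : v ∈ range (ι (q + 1))) {t : ℝ} (ht : 0 ≤ t) :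
    HasDerivWithinAt (fun t => app B (S t v)) (app B (S t (app L v))) (Ici 0) t := by
  have hL := h.hasOrder_gen hS hLS
  have hvq := h.antitone _ _ q.le_succ hv
  obtain ⟨hvd, hLv⟩ := hL.sends (add_comm q 1) hq hv
  obtain ⟨g, hgc, hg⟩ := h.orbit q (by omega) v hvq
  obtain ⟨w, hwc, hw⟩ := h.orbit q (by omega) _ hLv
  -- The integrated equation in `H q` is checked after the injective embedding into `X`, where it is
  -- the semigroup identity.
  have hd := hasDerivWithinAt_Ici_of_sub_eq_integral (g := g) hwc (fun s hs => by
    apply h.injective q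
    rw [← ContinuousLinearMap.intervalIntegral_comp_comm _
      (ContinuousOn.intervalIntegrable_of_Icc hs (hwc.mono Icc_subset_Ici_self)), map_sub,
      hg s hs, hg 0 le_rfl, hS.zero]
    simp only [ContinuousLinearMap.id_apply]
    rw [hLS.sub_eq_integral hS hvd hs, ← app_of_mem hvd]
    refine intervalIntegral.integral_congr fun τ hτ => ?_
    rw [uIcc_of_le hs] at hτ
    exact (hw τ hτ.1).symm) ht
  obtain ⟨C, hC⟩ := hB q 0 rfl (by omega)
  have hd' := (((ι 0).comp C).restrictScalars ℝ).hasFDerivAt.comp_hasDerivWithinAt t hd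
  have heq : ∀ s, 0 ≤ s → app B (S s v) = ι 0 (C (g s)) := fun s hs => by
    rw [← hg s hs]; exact (hC _).app_eq
  have heq' : app B (S t (app L v)) = ι 0 (C (w t)) := by
    rw [← hw t ht]; exact (hC _).app_eq
  rw [heq']
  exact hd'.congr_of_mem (fun s hs => heq s hs) ht

/-- The function `g τ = e^{cτ} B S(τ) v` satisfies `g' = L g + (c g - e^{cτ} [L, B] S(τ) v)`.
Duhamel's formula for `g`, solved for the integral of `c g`, is the claim. -/
theorem IsScale.integral_by_parts (h : IsScale L S α ι M) (hS : IsC0Semigroup S)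
    (hLS : IsGenerator L S) (hB : HasOrder ι M B q) (hq : q + 1 ≤ M)
    {v : X} (hv : v ∈ range (ι (q + 1))) (c : ℂ) {t : ℝ} (ht : 0 ≤ t) :
    c • ∫ τ in (0 : ℝ)..t, Complex.exp (c * τ) • S (t - τ) (app B (S τ v)) =
      Complex.exp (c * t) • app B (S t v) - S t (app B v) +
        ∫ τ in (0 : ℝ)..t, Complex.exp (c * τ) •
          S (t - τ) (app (pcomp L B - pcomp B L) (S τ v)) := by
  have hL := h.hasOrder_gen hS hLS
  have hvq := h.antitone _ _ q.le_succ hv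
  have had : HasOrder ι M (pcomp L B - pcomp B L) (q + 1) := by
    have h1 := hL.pcomp hB
    rw [add_comm 1] at h1
    exact h1.sub (hB.pcomp hL)
  have hBc := (h.continuousOn_app hB (by omega) hvq).mono (Icc_subset_Ici_self : Icc 0 t ⊆ Ici 0)
  have hadc := (h.continuousOn_app had hq hv).mono (Icc_subset_Ici_self : Icc 0 t ⊆ Ici 0)
  have hec : ContinuousOn (fun τ : ℝ => Complex.exp (c * τ)) (Icc 0 t) := by fun_prop
  have hvar := hLS.variation_of_constants hS (T := t)
    (g := fun τ => Complex.exp (c * τ) • app B (S τ v))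
    (r := fun τ => c • (Complex.exp (c * τ) • app B (S τ v)) -
      Complex.exp (c * τ) • app (pcomp L B - pcomp B L) (S τ v))
    (((hec.smul hBc).const_smul c).sub (hec.smul hadc)) ?_ (right_mem_Icc.2 ht)
  · simp only [Complex.ofReal_zero, mul_zero, Complex.exp_zero, one_smul, hS.zero,
      ContinuousLinearMap.id_apply, map_sub, map_smul] at hvar
    rw [intervalIntegral.integral_sub, intervalIntegral.integral_smul] at hvar
    · rw [hvar]; abel
    · have := (hS.intervalIntegrable_convolution (right_mem_Icc.2 ht)
        (f := fun τ => c • (Complex.exp (c * τ) • app B (S τ v))) ((hec.smul hBc).const_smul c))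
      simpa only [map_smul] using this
    · have := (hS.intervalIntegrable_convolution (right_mem_Icc.2 ht)
        (f := fun τ => Complex.exp (c * τ) • app (pcomp L B - pcomp B L) (S τ v))
          (hec.smul hadc))
      simpa only [map_smul] using this
  · intro τ hτ
    have hτv := h.semigroup_mem hq hv hτ.1
    -- The spare unit is spent here: `B S(τ) v` must stay in the space with index one for `L` to
    -- apply.
    obtain ⟨hd1, hr1⟩ := hB.sends (j := 1) rfl hq hτv
    obtain ⟨hd2, -⟩ := hL.sends (j := 0) rfl (by omega) hr1
    obtain ⟨hvd, hLv⟩ := hL.sends (add_comm q 1) hq hv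
    have hLS1 := hLS.map_semigroup hS hvd hτ.1
    have hs1 : Sends (pcomp L B) (S τ v) (app L (app B (S τ v))) :=
      (sends_app hd1).pcomp (sends_app hd2)
    have hs2 : Sends (pcomp B L) (S τ v) (app B (S τ (app L v))) := by
      rw [← app_of_mem hvd] at hLS1
      exact Sends.pcomp hLS1 (sends_app (hB.sends (j := 0) rfl (by omega)
        (h.semigroup_mem (by omega) hLv hτ.1)).1)
    obtain ⟨hd3, he3⟩ := (sends_app hd2).map_smul (Complex.exp (c * τ))
    refine ⟨hd3, ?_⟩
    rw [he3, (hs1.sub hs2).app_eq]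
    have hder := (h.hasDerivWithinAt_app hS hLS hB hq hv hτ.1).mono
      (Icc_subset_Ici_self : Icc 0 t ⊆ Ici 0)
    have hexp : HasDerivAt (fun τ : ℝ => Complex.exp (c * τ)) (Complex.exp (c * τ) * c) τ := by
      have := ((hasDerivAt_id (τ : ℂ)).const_mul c).cexp.comp_ofReal
      simpa using this
    refine (hexp.hasDerivWithinAt.smul hder).congr_deriv ?_
    rw [smul_sub, smul_smul, mul_comm c (Complex.exp _)]
    abel

end Scale

/-! ### Multi-indices and the recursions for the coefficients -/

section Combinatorics

/-- Splits off the last entry `k_{d+1}`, which is the number of integrations by parts in the step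
from `d` to `d + 1`. -/
theorem sum_multiIdx_succ {Y : Type*} [AddCommMonoid Y] (d s : ℕ) (f : (ℕ → ℕ) → Y) :
    ∑ k ∈ multiIdx (d + 1) s, f k =
      ∑ p ∈ Finset.HasAntidiagonal.antidiagonal s, ∑ k ∈ multiIdx d p.2,
        f (Function.update k (d + 1) p.1) := by
  have hd : d + 1 ∉ Finset.Icc 1 d := by simp
  have hupd : ∀ (p : ℕ × ℕ), ∀ k ∈ multiIdx d p.2,
      (fun j => k j + if j = d + 1 then p.1 else 0) = Function.update k (d + 1) p.1 := by
    intro p k hk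
    funext j
    rcases eq_or_ne j (d + 1) with rfl | hj
    · have : k (d + 1) = 0 := by
        by_contra h0
        exact hd ((Finset.mem_piAntidiag.1 hk).2 _ h0)
      simp [this]
    · simp [hj]
  have hIcc : Finset.Icc 1 (d + 1) = Finset.cons (d + 1) (Finset.Icc 1 d) hd := by
    ext; simp only [Finset.mem_Icc, Finset.mem_cons]; omega
  rw [multiIdx, hIcc, Finset.piAntidiag_cons, Finset.sum_disjiUnion]
  refine Finset.sum_congr rfl fun p _ => ?_
  rw [Finset.sum_map]
  refine Finset.sum_congr rfl fun k hk => ?_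
  rw [← hupd p k hk]
  rfl

theorem sum_of_mem_multiIdx {d q : ℕ} {k : ℕ → ℕ} (hk : k ∈ multiIdx d q) :
    ∑ i ∈ Finset.Icc 1 d, k i = q := (Finset.mem_piAntidiag.1 hk).1

/-- The outer range on the right contains `q = n`, whose inner sum is empty, to match the range of
lengths in `serS`. -/
theorem sum_range_antidiagonal {Y : Type*} [AddCommMonoid Y] (n : ℕ) (g : ℕ → ℕ → Y) :
    ∑ s ∈ Finset.range n, ∑ p ∈ Finset.HasAntidiagonal.antidiagonal s, g p.1 p.2 =
      ∑ q ∈ Finset.range (n + 1), ∑ κ ∈ Finset.range (n - q), g κ q := by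
  rw [Finset.sum_sigma', Finset.sum_sigma']
  refine Finset.sum_nbij' (fun x => ⟨x.2.2, x.2.1⟩) (fun y => ⟨y.1 + y.2, (y.2, y.1)⟩)
    ?_ ?_ ?_ ?_ ?_
  · rintro ⟨s, a, b⟩ h
    simp only [Finset.mem_sigma, Finset.mem_range, Finset.HasAntidiagonal.mem_antidiagonal] at h ⊢
    omega
  · rintro ⟨q, κ⟩ h
    simp only [Finset.mem_sigma, Finset.mem_range, Finset.HasAntidiagonal.mem_antidiagonal] at h ⊢
    omega
  · rintro ⟨s, a, b⟩ h
    simp only [Finset.mem_sigma, Finset.mem_range, Finset.HasAntidiagonal.mem_antidiagonal] at h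
    obtain ⟨-, rfl⟩ := h
    rw [add_comm b a]
  · rintro ⟨q, κ⟩ _
    rfl
  · rintro ⟨s, a, b⟩ _
    rfl

theorem sum_antidiagonal_eq_sum_range {Y : Type*} [AddCommMonoid Y] (n : ℕ) (g : ℕ → ℕ → Y) :
    ∑ p ∈ Finset.HasAntidiagonal.antidiagonal n, g p.1 p.2 =
      ∑ q ∈ Finset.range (n + 1), g (n - q) q := by
  rw [← Finset.Nat.sum_antidiagonal_swap]
  exact Finset.Nat.sum_antidiagonal_eq_sum_range_succ (fun q κ => g κ q) n

theorem coefA_zero (k : ℕ → ℕ) (l : ℕ) : coefA k l 0 = 1 := by simp [coefA]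

/-- The divisor is the frequency factor collected by a boundary term after `k_{d+1} + 1`
integrations by parts. -/
theorem coefA_succ (k : ℕ → ℕ) (d j : ℕ) :
    coefA k (d + 1) (j + 1) = coefA k d j / ((j + 1 : ℕ) : ℚ) ^ (k (d + 1) + 1) := by
  rw [coefA, coefA, Finset.prod_range_succ', div_div]
  simp only [Nat.add_sub_add_right, Nat.sub_zero]

/-- The unfinished integral has undergone only `k_{d+1}` integrations by parts, hence one power
fewer than in `coefA_succ`. -/
theorem coefB_succ (k : ℕ → ℕ) (d j : ℕ) :
    coefB k (d + 1) (j + 1) = coefA k d j / ((j + 1 : ℕ) : ℚ) ^ k (d + 1) := by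
  rw [coefB, coefA, if_neg (Nat.succ_ne_zero j), Finset.prod_Ico_eq_prod_range, div_div, mul_comm]
  simp only [Nat.add_sub_cancel, Nat.add_comm 1, Nat.add_sub_add_right]

theorem coefA_congr {k k' : ℕ → ℕ} {l : ℕ} (h : ∀ i ≤ l, k i = k' i) (j : ℕ) :
    coefA k l j = coefA k' l j := by
  simp only [coefA, h _ (Nat.sub_le l _)]

variable {X : Type*} [NormedAddCommGroup X] [NormedSpace ℂ X] (L : X →ₗ.[ℂ] X) (α : X →L[ℂ] X)

theorem opN_congr {k k' : ℕ → ℕ} (l : ℕ) {r : ℕ} (h : ∀ i ≤ r, k i = k' i) :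
    opN L α k l r = opN L α k' l r := by
  induction r with
  | zero => rfl
  | succ r ih => rw [opN, opN, ih fun i hi => h i (hi.trans r.le_succ), h _ le_rfl]

theorem opF_congr {k k' : ℕ → ℕ} {l : ℕ} (h : ∀ i ≤ l, k i = k' i) :
    opF L α k l = opF L α k' l := by
  induction l using Nat.strong_induction_on with
  | _ l ih =>
    cases l with
    | zero => rw [opF, opF]
    | succ l =>
      rw [opF, opF]
      congr 1
      refine Finset.sum_congr rfl fun m _ => ?_
      rw [coefA_congr h, opN_congr L α _ h, ih m m.isLt fun i hi => h i (hi.trans m.isLt.le)]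

theorem opN_self_succ (k : ℕ → ℕ) (r : ℕ) :
    opN L α k (r + 1) r = full (ContinuousLinearMap.id ℂ X) := by
  cases r with
  | zero => rfl
  | succ r => rw [opN, if_neg (by omega)]

theorem update_apply_of_le (k : ℕ → ℕ) (κ : ℕ) {d : ℕ} :
    ∀ i ≤ d, k i = Function.update k (d + 1) κ i :=
  fun i hi => (Function.update_of_ne (by omega) _ _).symm

theorem opN_update_succ (k : ℕ → ℕ) (κ : ℕ) {l d : ℕ} (hl : l ≤ d + 1) :
    opN L α (Function.update k (d + 1) κ) l (d + 1) =
      adPow L (pcomp (full α) (opN L α k l d)) κ := by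
  rw [opN, if_pos hl, Function.update_self, ← opN_congr L α l (update_apply_of_le k κ)]

theorem osc_zero (ω t : ℝ) : osc ω 0 t = 1 := by simp [osc]

theorem osc_one_mul (ω t : ℝ) (s : ℕ) : osc ω 1 t * osc ω s t = osc ω (s + 1) t := by
  rw [osc, osc, osc, ← Complex.exp_add]
  congr 1
  push_cast
  ring

theorem norm_osc (ω t : ℝ) (s : ℕ) : ‖osc ω s t‖ = 1 := by
  rw [osc, show Complex.I * s * ω * t = ((s * ω * t : ℝ) : ℂ) * Complex.I by push_cast; ring]
  exact Complex.norm_exp_ofReal_mul_I _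

theorem continuous_osc (ω : ℝ) (s : ℕ) : Continuous (osc ω s) := by
  unfold osc
  fun_prop

end Combinatorics

/-! ### Iterated integration by parts and well-definedness -/

section Expansion

variable {X : Type*} [NormedAddCommGroup X] [NormedSpace ℂ X] [CompleteSpace X]
  {H : ℕ → Type*} [∀ j, NormedAddCommGroup (H j)] [∀ j, NormedSpace ℂ (H j)]
  [∀ j, CompleteSpace (H j)]
  {L : X →ₗ.[ℂ] X} {S : ℝ → X →L[ℂ] X} {α : X →L[ℂ] X} {ι : ∀ j, H j →L[ℂ] X} {M : ℕ}

/-- The integral left by one step has the same shape with one more commutator, so `K` steps use `K`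
units of regularity. -/
theorem IsScale.integral_by_parts_iterate (h : IsScale L S α ι M) (hS : IsC0Semigroup S)
    (hLS : IsGenerator L S) {B : X →ₗ.[ℂ] X} {q : ℕ} (hB : HasOrder ι M B q) {c : ℂ} (hc : c ≠ 0)
    {t : ℝ} (ht : 0 ≤ t) {v : X} (K : ℕ) (hq : q + K ≤ M) (hv : v ∈ range (ι (q + K))) :
    ∫ τ in (0 : ℝ)..t, Complex.exp (c * τ) • S (t - τ) (app B (S τ v)) =
      ∑ κ ∈ Finset.range K, (1 / c ^ (κ + 1)) •
        (Complex.exp (c * t) • app (adPow L B κ) (S t v) - S t (app (adPow L B κ) v)) +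
      (1 / c ^ K) • ∫ τ in (0 : ℝ)..t, Complex.exp (c * τ) •
          S (t - τ) (app (adPow L B K) (S τ v)) := by
  induction K with
  | zero => simp [adPow]
  | succ K ih =>
    rw [ih (by omega) (h.antitone _ _ (by omega) hv), Finset.sum_range_succ, add_assoc]
    congr 1
    have hibp := h.integral_by_parts hS hLS ((h.hasOrder_gen hS hLS).adPow hB K) hq hv c ht
    rw [← eq_inv_smul_iff₀ hc] at hibp
    rw [hibp, smul_smul, smul_add, one_div, one_div, pow_succ, mul_inv]
    rfl

/-- `F_l u₀` lies in the domains that are needed. -/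
theorem IsScale.opF_mem (h : IsScale L S α ι M) (hS : IsC0Semigroup S) (hLS : IsGenerator L S)
    {u₀ : X} (hu : u₀ ∈ range (ι M)) {k : ℕ → ℕ} {l d j : ℕ} (hl : l ≤ d)
    (hk : ∑ i ∈ Finset.Icc 1 d, k i + j ≤ M) :
    u₀ ∈ (opF L α k l).domain ∧
      app (opF L α k l) u₀ ∈ range (ι (∑ i ∈ Finset.Icc (l + 1) d, k i + j)) := by
  have hsum : ∑ i ∈ Finset.Icc 1 l, k i + ∑ i ∈ Finset.Icc (l + 1) d, k i =
      ∑ i ∈ Finset.Icc 1 d, k i := by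
    have hIcc : ∀ a b : ℕ, Finset.Icc (a + 1) b = Finset.Ioc a b := fun a b => by
      ext; simp
    have := Finset.sum_Ioc_consecutive k (Nat.zero_le l) hl
    simpa only [hIcc] using this
  exact ((h.hasOrder_gen hS hLS).opF h.hasOrder_mul k l).sends (by rw [← add_assoc, hsum]) hk
    (h.antitone _ _ hk hu)

/-- `F_l` uses up `k_1 + ⋯ + k_l` units and `N_{k_{l+1}}^{k_d}` the remaining ones, while `S t`
preserves every space of the scale. -/
theorem IsScale.wellDefined (h : IsScale L S α ι M) (hS : IsC0Semigroup S)
    (hLS : IsGenerator L S) {u₀ : X} (hu : u₀ ∈ range (ι M)) {k : ℕ → ℕ} {l d : ℕ} (hl : l ≤ d)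
    (hk : ∑ i ∈ Finset.Icc 1 d, k i ≤ M) :
    u₀ ∈ (opF L α k l).domain ∧
      (∀ t, 0 ≤ t → S t (app (opF L α k l) u₀) ∈ (opN L α k (l + 1) d).domain) ∧
      ContinuousOn (fun t => app (opN L α k (l + 1) d) (S t (app (opF L α k l) u₀))) (Ici 0) := by
  obtain ⟨h1, h2⟩ := h.opF_mem hS hLS hu (j := 0) hl hk
  have hN := (h.hasOrder_gen hS hLS).opN h.hasOrder_mul k (Nat.le_add_left 1 l) d
  have hle : ∑ i ∈ Finset.Icc (l + 1) d, k i ≤ M :=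
    (Finset.sum_le_sum_of_subset (Finset.Icc_subset_Icc_left (by omega))).trans hk
  exact ⟨h1, fun t ht => (hN.sends (j := 0) rfl hle (h.semigroup_mem hle h2 ht)).1,
    h.continuousOn_app hN hle h2⟩

end Expansion

/-! ### Building blocks of the expansion -/

section Terms

variable {X : Type*} [NormedAddCommGroup X] [NormedSpace ℂ X]
  (L : X →ₗ.[ℂ] X) (S : ℝ → X →L[ℂ] X) (α : X →L[ℂ] X) (u₀ : X)

/-- The vector `N_{k_{l+1}}^{k_d} e^{tL} F_l u₀`. -/
noncomputable def vecN (k : ℕ → ℕ) (l d : ℕ) (t : ℝ) : X :=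
  app (opN L α k (l + 1) d) (S t (app (opF L α k l) u₀))

/-- The boundary terms of an integration by parts. -/
noncomputable def boundaryTerm (ω : ℝ) (k : ℕ → ℕ) (l d : ℕ) (t : ℝ) : X :=
  osc ω (d - l) t • vecN L S α u₀ k l d t -
    S t (app (opN L α k (l + 1) d) (app (opF L α k l) u₀))

/-- An oscillatory integral of `N_{k_{l+1}}^{k_d} e^{tL} F_l u₀`. -/
noncomputable def integralTerm (ω : ℝ) (k : ℕ → ℕ) (l d : ℕ) (t : ℝ) : X :=
  ∫ τ in (0 : ℝ)..t, osc ω (d - l) τ • S (t - τ) (vecN L S α u₀ k l d τ)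

variable {L S α u₀}

theorem errE_succ (ω : ℝ) (n d : ℕ) (t : ℝ) : errE L S α u₀ ω n (d + 1) t =
    ∑ k ∈ multiIdx (d + 1) (n - d), ∑ l ∈ Finset.range (d + 1), (1 / (Complex.I * ω) ^ n) •
      ((coefB k (d + 1) (d + 1 - l) : ℚ) : ℂ) • integralTerm L S α u₀ ω k l (d + 1) t
    + ∫ τ in (0 : ℝ)..t, S (t - τ) (α (osc ω 1 τ • errE L S α u₀ ω n d τ)) := by
  rw [errE]
  simp only [Finset.smul_sum]
  rfl

end Terms

/-! ### Asymptotic expansion of the iterated integrals -/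

section Expansion

variable {X : Type*} [NormedAddCommGroup X] [NormedSpace ℂ X] [CompleteSpace X]
  {H : ℕ → Type*} [∀ j, NormedAddCommGroup (H j)] [∀ j, NormedSpace ℂ (H j)]
  [∀ j, CompleteSpace (H j)]
  {L : X →ₗ.[ℂ] X} {S : ℝ → X →L[ℂ] X} {α : X →L[ℂ] X} {ι : ∀ j, H j →L[ℂ] X} {M : ℕ}
  {u₀ : X}

theorem IsScale.opF_succ_app (h : IsScale L S α ι M) (hS : IsC0Semigroup S)
    (hLS : IsGenerator L S) (hu : u₀ ∈ range (ι M)) {k : ℕ → ℕ} {d : ℕ}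
    (hk : ∑ i ∈ Finset.Icc 1 (d + 1), k i ≤ M) :
    app (opF L α k (d + 1)) u₀ = -∑ m ∈ Finset.range (d + 1),
      ((coefA k (d + 1) (d + 1 - m) : ℚ) : ℂ) •
        app (opN L α k (m + 1) (d + 1)) (app (opF L α k m) u₀) := by
  rw [Finset.sum_range, opF]
  refine (Sends.neg (Sends.sum fun m _ => Sends.smul _ ?_)).app_eq
  obtain ⟨h1, h2⟩ := h.opF_mem hS hLS hu (j := 0) (m.isLt.le : (m : ℕ) ≤ d + 1) hk
  have hN := (h.hasOrder_gen hS hLS).opN h.hasOrder_mul k (Nat.le_add_left 1 (m : ℕ)) (d + 1)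
  have hle : ∑ i ∈ Finset.Icc ((m : ℕ) + 1) (d + 1), k i ≤ M :=
    (Finset.sum_le_sum_of_subset (Finset.Icc_subset_Icc_left (by omega))).trans hk
  exact (sends_app h1).pcomp (sends_app (hN.sends (j := 0) rfl hle h2).1)

/-- The summand `l = d + 1` has frequency zero, coefficient one and trivial `N`. By definition of
`F_{d+1}` it is minus the sum of the lower boundary values, which are thus distributed over the
summands `l ≤ d`. -/
theorem IsScale.serS_succ (h : IsScale L S α ι M) (hS : IsC0Semigroup S)
    (hLS : IsGenerator L S) (hu : u₀ ∈ range (ι M)) {d : ℕ} (hd : d + 1 ≤ M) (ω t : ℝ) :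
    serS L S α u₀ ω M (d + 1) t = ∑ s ∈ Finset.range (M - d), ∑ k ∈ multiIdx (d + 1) s,
      ∑ l ∈ Finset.range (d + 1), (1 / (Complex.I * ω) ^ (d + 1 + s)) •
        ((coefA k (d + 1) (d + 1 - l) : ℚ) : ℂ) • boundaryTerm L S α u₀ ω k l (d + 1) t := by
  rw [serS, show M - (d + 1) + 1 = M - d by omega]
  refine Finset.sum_congr rfl fun s hs => Finset.sum_congr rfl fun k hk => ?_
  rw [Finset.mem_range] at hs
  have hk' : ∑ i ∈ Finset.Icc 1 (d + 1), k i ≤ M := by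
    rw [sum_of_mem_multiIdx hk]; omega
  rw [← Finset.smul_sum]
  congr 1
  rw [Finset.sum_range_succ, opN_self_succ, (sends_full _ _).app_eq, ContinuousLinearMap.id_apply,
    Nat.sub_self, coefA_zero, osc_zero, h.opF_succ_app hS hLS hu hk', Rat.cast_one, one_mul,
    one_smul, map_neg, map_sum, ← sub_eq_add_neg, ← Finset.sum_sub_distrib]
  refine Finset.sum_congr rfl fun l _ => ?_
  rw [boundaryTerm, smul_sub, mul_smul, map_smul]
  rfl

/-- A term carrying `ω^{-(d+q)}` is integrated by parts `M - d - q` times, which brings the leftover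
integral to exactly `ω^{-M}`. The number `κ` of steps already taken becomes the new entry `k_{d+1}`.
-/
theorem IsScale.integral_expand (h : IsScale L S α ι M) (hS : IsC0Semigroup S)
    (hLS : IsGenerator L S) (hu : u₀ ∈ range (ι M)) {k : ℕ → ℕ} {d q l : ℕ}
    (hk : ∑ i ∈ Finset.Icc 1 d, k i = q) (hq : d + q ≤ M) (hl : l ≤ d) {ω : ℝ} (hω : 0 < ω)
    {t : ℝ} (ht : 0 ≤ t) :
    (1 / (Complex.I * ω) ^ (d + q)) • ((coefA k d (d - l) : ℚ) : ℂ) • ∫ τ in (0 : ℝ)..t,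
        osc ω (d + 1 - l) τ • S (t - τ) (α (vecN L S α u₀ k l d τ)) =
      ∑ κ ∈ Finset.range (M - d - q), (1 / (Complex.I * ω) ^ (d + 1 + (κ + q))) •
        ((coefA (Function.update k (d + 1) κ) (d + 1) (d + 1 - l) : ℚ) : ℂ) •
          boundaryTerm L S α u₀ ω (Function.update k (d + 1) κ) l (d + 1) t +
      (1 / (Complex.I * ω) ^ M) •
        ((coefB (Function.update k (d + 1) (M - d - q)) (d + 1) (d + 1 - l) : ℚ) : ℂ) •
          integralTerm L S α u₀ ω (Function.update k (d + 1) (M - d - q)) l (d + 1) t := by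
  obtain ⟨j, rfl⟩ := Nat.exists_eq_add_of_le hl
  have hj : l + j + 1 - l = j + 1 := by omega
  have hω' : (ω : ℂ) ≠ 0 := by exact_mod_cast hω.ne'
  have hj0 : ((j + 1 : ℕ) : ℂ) ≠ 0 := by exact_mod_cast j.succ_ne_zero
  -- Non-resonance: with `j = d - l`, multiplication by `e^{iωτ}` has raised the frequency to `j + 1
  -- ≥ 1`.
  have hc : Complex.I * ((j + 1 : ℕ) : ℂ) * ω ≠ 0 :=
    mul_ne_zero (mul_ne_zero Complex.I_ne_zero hj0) hω'
  have hcpow : ∀ r, (Complex.I * ((j + 1 : ℕ) : ℂ) * ω) ^ r =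
      (Complex.I * ω) ^ r * ((j + 1 : ℕ) : ℂ) ^ r := fun r => by
    rw [← mul_pow]; congr 1; ring
  obtain ⟨hF, hFm⟩ := h.opF_mem hS hLS hu (k := k) (j := M - (l + j) - q) hl (by omega)
  obtain ⟨-, hdom, -⟩ := h.wellDefined hS hLS hu (k := k) hl (by omega)
  have hle : ∑ i ∈ Finset.Icc (l + 1) (l + j), k i ≤ q :=
    (Finset.sum_le_sum_of_subset (Finset.Icc_subset_Icc_left (by omega))).trans hk.le
  have hB := h.hasOrder_mul.pcomp
    ((h.hasOrder_gen hS hLS).opN h.hasOrder_mul k (Nat.le_add_left 1 l) (l + j))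
  rw [zero_add] at hB
  have key := h.integral_by_parts_iterate hS hLS hB hc ht (M - (l + j) - q) (by omega) hFm
  have hint : ∫ τ in (0 : ℝ)..t, osc ω (j + 1) τ • S (t - τ) (α (vecN L S α u₀ k l (l + j) τ)) =
      ∫ τ in (0 : ℝ)..t, Complex.exp (Complex.I * ((j + 1 : ℕ) : ℂ) * ω * τ) •
        S (t - τ) (app (pcomp (full α) (opN L α k (l + 1) (l + j)))
          (S τ (app (opF L α k l) u₀))) := by
    refine intervalIntegral.integral_congr fun τ hτ => ?_
    rw [uIcc_of_le ht] at hτ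
    simp only [vecN]
    rw [((sends_app (hdom τ hτ.1)).pcomp (sends_full α _)).app_eq]
    rfl
  have hFeq : ∀ κ, opF L α (Function.update k (l + j + 1) κ) l = opF L α k l := fun κ =>
    (opF_congr L α fun i hi => update_apply_of_le k κ i (hi.trans hl)).symm
  have hNeq : ∀ κ, opN L α (Function.update k (l + j + 1) κ) (l + 1) (l + j + 1) =
      adPow L (pcomp (full α) (opN L α k (l + 1) (l + j))) κ := fun κ =>
    opN_update_succ L α k κ (by omega)
  have hAeq : ∀ κ, coefA (Function.update k (l + j + 1) κ) (l + j) j = coefA k (l + j) j :=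
    fun κ => (coefA_congr (update_apply_of_le k κ) j).symm
  rw [Nat.add_sub_cancel_left, hj, hint, key, smul_add, smul_add, Finset.smul_sum, Finset.smul_sum]
  congr 1
  · refine Finset.sum_congr rfl fun κ _ => ?_
    rw [boundaryTerm, vecN, hFeq, hNeq, coefA_succ, hAeq, Function.update_self, hj, smul_smul,
      smul_smul, smul_smul, hcpow]
    congr 1
    push_cast at hj0 ⊢
    have h1 : (Complex.I * (ω : ℂ)) ≠ 0 := mul_ne_zero Complex.I_ne_zero hω'
    rw [show l + j + 1 + (κ + q) = (l + j + q) + (κ + 1) by ring, pow_add _ (l + j + q) (κ + 1)]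
    field_simp
  · rw [integralTerm]
    simp only [vecN]
    rw [hFeq, hNeq, coefB_succ, hAeq, Function.update_self, hj, smul_smul, smul_smul, smul_smul,
      hcpow]
    congr 1
    push_cast at hj0 ⊢
    have h1 : (Complex.I * (ω : ℂ)) ≠ 0 := mul_ne_zero Complex.I_ne_zero hω'
    rw [show (Complex.I * (ω : ℂ)) ^ M = (Complex.I * ω) ^ (l + j + q) *
      (Complex.I * ω) ^ (M - (l + j) - q) by rw [← pow_add]; congr 1; omega]
    field_simp

theorem IsScale.continuousOn_serS (h : IsScale L S α ι M) (hS : IsC0Semigroup S)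
    (hLS : IsGenerator L S) (hu : u₀ ∈ range (ι M)) {d : ℕ} (hd : d ≤ M) (ω : ℝ) :
    ContinuousOn (serS L S α u₀ ω M d) (Ici 0) := by
  unfold serS
  refine continuousOn_finsetSum _ fun q hq => continuousOn_finsetSum _ fun k hk =>
    ContinuousOn.const_smul (continuousOn_finsetSum _ fun l hl => ?_) _
  rw [Finset.mem_range] at hq hl
  have hk' : ∑ i ∈ Finset.Icc 1 d, k i ≤ M := by
    rw [sum_of_mem_multiIdx hk]; omega
  exact (continuous_const.mul (continuous_osc ω _)).continuousOn.smul
    (h.wellDefined hS hLS hu (by omega) hk').2.2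

theorem continuousOn_oscInt (hS : IsC0Semigroup S) {T : ℝ} (hT : 0 ≤ T) (ω : ℝ) (d : ℕ) :
    ContinuousOn (oscInt S α u₀ ω d) (Icc 0 T) := by
  induction d with
  | zero => exact (hS.cont u₀).mono Icc_subset_Ici_self
  | succ d ih =>
    exact hS.continuousOn_convolution hT
      (α.continuous.comp_continuousOn ((continuous_osc ω 1).continuousOn.smul ih))

/-- The asymptotic expansion of the iterated oscillatory integrals. -/
theorem IsScale.oscInt_eq (h : IsScale L S α ι M) (hS : IsC0Semigroup S)
    (hLS : IsGenerator L S) (hu : u₀ ∈ range (ι M)) {ω : ℝ} (hω : 0 < ω) {d : ℕ} (hd : d ≤ M)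
    {t : ℝ} (ht : 0 ≤ t) :
    oscInt S α u₀ ω d t = serS L S α u₀ ω M d t + errE L S α u₀ ω M d t := by
  induction d generalizing t with
  | zero =>
    -- For `d = 0` there is only the empty multi-index, of length zero.
    rw [errE, add_zero, serS, Finset.sum_eq_single 0]
    · simp [multiIdx, coefA_zero, osc_zero, opN, opF, (sends_full _ _).app_eq, oscInt]
    · intro q _ hq
      simp [multiIdx, Finset.piAntidiag_empty_of_ne_zero hq]
    · simp
  | succ d ih =>
    have hd' : d ≤ M := by omega
    have hser := h.continuousOn_serS hS hLS hu hd' ω (α := α) |>.mono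
      (Icc_subset_Ici_self : Icc 0 t ⊆ Ici 0)
    -- Continuity of `E^d` is inherited from `T^d - S^d` through the induction hypothesis.
    have herr : ContinuousOn (errE L S α u₀ ω M d) (Icc 0 t) :=
      ((continuousOn_oscInt hS ht ω d).sub hser).congr fun τ hτ => by
        simp only [Pi.sub_apply]
        rw [ih hd' hτ.1]; abel
    have hosc := (continuous_osc ω 1).continuousOn (s := Icc 0 t)
    have htt : t ∈ Icc 0 t := right_mem_Icc.2 ht
    have hsplit : oscInt S α u₀ ω (d + 1) t =
        (∫ τ in (0 : ℝ)..t, S (t - τ) (α (osc ω 1 τ • serS L S α u₀ ω M d τ))) +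
        ∫ τ in (0 : ℝ)..t, S (t - τ) (α (osc ω 1 τ • errE L S α u₀ ω M d τ)) := by
      rw [← intervalIntegral.integral_add, oscInt]
      · refine intervalIntegral.integral_congr fun τ hτ => ?_
        rw [uIcc_of_le ht] at hτ
        rw [ih hd' hτ.1, smul_add, map_add, map_add]
      · exact hS.intervalIntegrable_convolution htt
          (α.continuous.comp_continuousOn (hosc.smul hser))
      · exact hS.intervalIntegrable_convolution htt
          (α.continuous.comp_continuousOn (hosc.smul herr))
    -- The integral of `E^d` is the recursive part of `E^{d+1}`; only the integral of `S^d` remains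
    -- to be expanded.
    rw [hsplit, errE_succ, ← add_assoc]
    congr 1
    have hpull : ∫ τ in (0 : ℝ)..t, S (t - τ) (α (osc ω 1 τ • serS L S α u₀ ω M d τ)) =
        ∑ q ∈ Finset.range (M - d + 1), ∑ k ∈ multiIdx d q, ∑ l ∈ Finset.range (d + 1),
          (1 / (Complex.I * ω) ^ (d + q)) • ((coefA k d (d - l) : ℚ) : ℂ) • ∫ τ in (0 : ℝ)..t,
            osc ω (d + 1 - l) τ • S (t - τ) (α (vecN L S α u₀ k l d τ)) := by
      have hpt : ∀ τ, S (t - τ) (α (osc ω 1 τ • serS L S α u₀ ω M d τ)) =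
          ∑ q ∈ Finset.range (M - d + 1), ∑ k ∈ multiIdx d q, ∑ l ∈ Finset.range (d + 1),
            (1 / (Complex.I * ω) ^ (d + q)) • ((coefA k d (d - l) : ℚ) : ℂ) •
              osc ω (d + 1 - l) τ • S (t - τ) (α (vecN L S α u₀ k l d τ)) := by
        intro τ
        rw [serS]
        simp only [Finset.smul_sum, map_sum, map_smul]
        refine Finset.sum_congr rfl fun q _ => Finset.sum_congr rfl fun k _ =>
          Finset.sum_congr rfl fun l hl => ?_
        rw [Finset.mem_range] at hl
        rw [show d + 1 - l = d - l + 1 by omega, ← osc_one_mul ω τ (d - l)]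
        simp only [smul_smul, vecN]
        congr 1
        ring
      have hii : ∀ q ∈ Finset.range (M - d + 1), ∀ k ∈ multiIdx d q, ∀ l ∈ Finset.range (d + 1),
          IntervalIntegrable (fun τ => (1 / (Complex.I * (ω : ℂ)) ^ (d + q)) •
            ((coefA k d (d - l) : ℚ) : ℂ) •
              osc ω (d + 1 - l) τ • S (t - τ) (α (vecN L S α u₀ k l d τ))) volume 0 t := by
        intro q hq k hk l hl
        rw [Finset.mem_range] at hq hl
        have hk' : ∑ i ∈ Finset.Icc 1 d, k i ≤ M := by
          rw [sum_of_mem_multiIdx hk]; omega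
        have hv := ((h.wellDefined hS hLS hu (by omega : l ≤ d) hk').2.2).mono
          (Icc_subset_Ici_self : Icc 0 t ⊆ Ici 0)
        have := hS.intervalIntegrable_convolution htt
          (f := fun τ => (1 / (Complex.I * (ω : ℂ)) ^ (d + q)) • ((coefA k d (d - l) : ℚ) : ℂ) •
            osc ω (d + 1 - l) τ • α (vecN L S α u₀ k l d τ))
          ((((continuous_osc ω (d + 1 - l)).continuousOn.smul
            (α.continuous.comp_continuousOn hv)).const_smul _).const_smul _)
        simpa only [map_smul] using this
      simp only [hpt]
      rw [intervalIntegral.integral_finsetSum fun q hq => ?_]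
      · refine Finset.sum_congr rfl fun q hq => ?_
        rw [intervalIntegral.integral_finsetSum fun k hk => ?_]
        · refine Finset.sum_congr rfl fun k hk => ?_
          rw [intervalIntegral.integral_finsetSum fun l hl => hii q hq k hk l hl]
          refine Finset.sum_congr rfl fun l hl => ?_
          rw [intervalIntegral.integral_smul, intervalIntegral.integral_smul]
        · simpa only [Finset.sum_fn] using
            IntervalIntegrable.sum _ fun l hl => hii q hq k hk l hl
      · simpa only [Finset.sum_fn] using IntervalIntegrable.sum _ fun k hk =>
          IntervalIntegrable.sum _ fun l hl => hii q hq k hk l hl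
    -- A multi-index of length `s` is split into its first `d` entries, of length `q`, and its last
    -- entry `κ = s - q`.
    have hser' : serS L S α u₀ ω M (d + 1) t = ∑ q ∈ Finset.range (M - d + 1),
        ∑ κ ∈ Finset.range (M - d - q), ∑ k ∈ multiIdx d q, ∑ l ∈ Finset.range (d + 1),
          (1 / (Complex.I * (ω : ℂ)) ^ (d + 1 + (κ + q))) •
            ((coefA (Function.update k (d + 1) κ) (d + 1) (d + 1 - l) : ℚ) : ℂ) •
              boundaryTerm L S α u₀ ω (Function.update k (d + 1) κ) l (d + 1) t := by
      rw [← sum_range_antidiagonal, h.serS_succ hS hLS hu hd]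
      refine Finset.sum_congr rfl fun s _ => ?_
      rw [sum_multiIdx_succ]
      refine Finset.sum_congr rfl fun p hp => ?_
      rw [Finset.HasAntidiagonal.mem_antidiagonal.1 hp]
    rw [hpull, hser', sum_multiIdx_succ, sum_antidiagonal_eq_sum_range (M - d) (fun κ q =>
      ∑ k ∈ multiIdx d q, ∑ l ∈ Finset.range (d + 1), (1 / (Complex.I * (ω : ℂ)) ^ M) •
        ((coefB (Function.update k (d + 1) κ) (d + 1) (d + 1 - l) : ℚ) : ℂ) •
          integralTerm L S α u₀ ω (Function.update k (d + 1) κ) l (d + 1) t),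
      ← Finset.sum_add_distrib]
    refine Finset.sum_congr rfl fun q hq => ?_
    rw [Finset.sum_comm (s := Finset.range (M - d - q)), ← Finset.sum_add_distrib]
    refine Finset.sum_congr rfl fun k hk => ?_
    rw [Finset.sum_comm (s := Finset.range (M - d - q)), ← Finset.sum_add_distrib]
    refine Finset.sum_congr rfl fun l hl => ?_
    rw [Finset.mem_range] at hq hl
    exact h.integral_expand hS hLS hu (sum_of_mem_multiIdx hk) (by omega) (by omega) hω ht

end Expansion

/-! ### Volterra estimates and the Dyson series -/

section Volterra

variable {X : Type*} [NormedAddCommGroup X] [NormedSpace ℂ X]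
  {S : ℝ → X →L[ℂ] X} {α : X →L[ℂ] X} {u₀ : X} {T K : ℝ}

/-- Integrating `c (cτ)^j / j!` gives the next term of the exponential series; the oscillating
factor has modulus one. -/
theorem norm_convolution_le (hK : ∀ t ∈ Icc 0 T, ‖S t‖ ≤ K) {f : ℝ → X} {A : ℝ} {j : ℕ} {c : ℝ}
    (hc : c = K * ‖α‖) (ω : ℝ) (hf : ∀ t ∈ Icc 0 T, ‖f t‖ ≤ A * ((c * t) ^ j / j.factorial))
    {t : ℝ} (ht : t ∈ Icc 0 T) :
    ‖∫ τ in (0 : ℝ)..t, S (t - τ) (α (osc ω 1 τ • f τ))‖ ≤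
      A * ((c * t) ^ (j + 1) / (j + 1).factorial) := by
  have hint : ∫ τ in (0 : ℝ)..t, c * (A * ((c * τ) ^ j / j.factorial)) =
      A * ((c * t) ^ (j + 1) / (j + 1).factorial) := by
    have hfun : ∀ τ : ℝ, c * (A * ((c * τ) ^ j / j.factorial)) =
        (A * c ^ (j + 1) / j.factorial) * τ ^ j :=
      fun τ => by rw [mul_pow, pow_succ]; ring
    simp_rw [hfun]
    rw [intervalIntegral.integral_const_mul, integral_pow, Nat.factorial_succ]
    have : (j.factorial : ℝ) ≠ 0 := by exact_mod_cast j.factorial_ne_zero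
    push_cast
    rw [mul_pow]
    field_simp
    simp
  rw [← hint]
  have hK0 : 0 ≤ K := (norm_nonneg _).trans (hK t ht)
  refine intervalIntegral.norm_integral_le_of_norm_le ht.1 (Eventually.of_forall fun τ hτ => ?_)
    (Continuous.intervalIntegrable (by fun_prop) _ _)
  rw [hc, mul_assoc]
  refine (S (t - τ)).le_of_opNorm_le_of_le
    (hK _ ⟨sub_nonneg.2 hτ.2, (sub_le_self _ hτ.1.le).trans ht.2⟩) ?_
  refine α.le_opNorm_of_le ?_
  rw [norm_smul, norm_osc, one_mul, ← hc]
  exact hf τ ⟨hτ.1.le, hτ.2.trans ht.2⟩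

/-- Starting from an arbitrary iterate `d` lets a small bound for `T^d` propagate to the whole tail.
-/
theorem norm_oscInt_add_le (hK : ∀ t ∈ Icc 0 T, ‖S t‖ ≤ K) {A : ℝ} {c : ℝ} (hc : c = K * ‖α‖)
    (ω : ℝ) {d : ℕ} (hd : ∀ t ∈ Icc 0 T, ‖oscInt S α u₀ ω d t‖ ≤ A) (j : ℕ) :
    ∀ t ∈ Icc 0 T, ‖oscInt S α u₀ ω (d + j) t‖ ≤ A * ((c * t) ^ j / j.factorial) := by
  induction j with
  | zero => simpa using hd
  | succ j ih => exact fun t ht => norm_convolution_le hK hc ω ih ht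

theorem mul_pow_div_factorial_le {A c t T : ℝ} (hA : 0 ≤ A) (hc : 0 ≤ c) (ht : t ∈ Icc 0 T)
    (j : ℕ) : A * ((c * t) ^ j / j.factorial) ≤ A * ((c * T) ^ j / j.factorial) := by
  have := ht.1
  have := ht.2
  gcongr

variable [CompleteSpace X] {L : X →ₗ.[ℂ] X}

/-- The Dyson series of a solution. -/
theorem IsSolution.hasSum_oscInt (hS : IsC0Semigroup S) (hLS : IsGenerator L S) {ω : ℝ}
    {u : ℝ → X} (hu : IsSolution L α u₀ ω T u) {t : ℝ} (ht : t ∈ Icc 0 T)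
    (hsum : Summable fun d => oscInt S α u₀ ω d t) :
    HasSum (fun d => oscInt S α u₀ ω d t) (u t) := by
  have hT : 0 ≤ T := ht.1.trans ht.2
  obtain ⟨K, -, hK⟩ := hS.exists_bound T
  have hK0 : 0 ≤ K := (norm_nonneg _).trans (hK t ht)
  have huc : ContinuousOn u (Icc 0 T) := fun τ hτ => (hu.deriv τ hτ).choose_spec.continuousWithinAt
  have hosc := (continuous_osc ω 1).continuousOn (s := Icc 0 T)
  have hduh : ∀ t ∈ Icc 0 T,
      u t = S t u₀ + ∫ τ in (0 : ℝ)..t, S (t - τ) (α (osc ω 1 τ • u τ)) := by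
    intro t ht
    have := hLS.variation_of_constants hS (r := fun τ => osc ω 1 τ • α (u τ))
      (hosc.smul (α.continuous.comp_continuousOn huc)) hu.deriv ht
    simpa only [hu.init, map_smul] using this
  obtain ⟨A, hA⟩ := isCompact_Icc.exists_bound_of_continuousOn huc
  -- The error of the `m`-th partial sum obeys the recursion of the iterated integrals, starting
  -- from the bounded function `u`.
  have hr : ∀ m, ∀ t ∈ Icc 0 T, ‖u t - ∑ d ∈ Finset.range m, oscInt S α u₀ ω d t‖ ≤
      A * ((K * ‖α‖ * t) ^ m / m.factorial) := by
    intro m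
    induction m with
    | zero => simpa using hA
    | succ m ih =>
      intro t ht
      have hsplit : u t - ∑ d ∈ Finset.range (m + 1), oscInt S α u₀ ω d t =
          ∫ τ in (0 : ℝ)..t, S (t - τ)
            (α (osc ω 1 τ • (u τ - ∑ d ∈ Finset.range m, oscInt S α u₀ ω d τ))) := by
        have hi1 : IntervalIntegrable (fun τ => S (t - τ) (α (osc ω 1 τ • u τ))) volume 0 t :=
          hS.intervalIntegrable_convolution ht (α.continuous.comp_continuousOn (hosc.smul huc))
        have hi2 : ∀ d ∈ Finset.range m, IntervalIntegrable
            (fun τ => S (t - τ) (α (osc ω 1 τ • oscInt S α u₀ ω d τ))) volume 0 t := fun d _ =>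
          hS.intervalIntegrable_convolution ht
            (α.continuous.comp_continuousOn (hosc.smul (continuousOn_oscInt hS hT ω d)))
        simp only [smul_sub, map_sub, Finset.smul_sum, map_sum]
        rw [intervalIntegral.integral_sub hi1
          (by simpa only [Finset.sum_fn] using IntervalIntegrable.sum _ hi2),
          intervalIntegral.integral_finsetSum hi2, Finset.sum_range_succ', hduh t ht]
        simp only [oscInt]
        abel
      rw [hsplit]
      exact norm_convolution_le hK rfl ω ih ht
  rw [hsum.hasSum_iff_tendsto_nat]
  rw [tendsto_iff_norm_sub_tendsto_zero]
  refine squeeze_zero (fun _ => norm_nonneg _) (fun m => ?_)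
    (by simpa using (FloorSemiring.tendsto_pow_div_factorial_atTop (K * ‖α‖ * t)).const_mul A)
  rw [norm_sub_rev]
  exact hr m t ht

/-- A majorant uniform in `t`, for the Weierstrass test. -/
theorem exists_norm_oscInt_le (hS : IsC0Semigroup S) (ω : ℝ) (hT : 0 ≤ T) (d : ℕ) :
    ∃ b : ℕ → ℝ, Summable b ∧ ∀ j, ∀ t ∈ Icc 0 T, ‖oscInt S α u₀ ω (d + j) t‖ ≤ b j := by
  obtain ⟨K, -, hK⟩ := hS.exists_bound T
  have hK0 : 0 ≤ K := (norm_nonneg _).trans (hK 0 (left_mem_Icc.2 hT))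
  obtain ⟨A, hA⟩ := isCompact_Icc.exists_bound_of_continuousOn
    (continuousOn_oscInt hS hT ω d (α := α) (u₀ := u₀))
  have hA0 : 0 ≤ A := (norm_nonneg _).trans (hA 0 (left_mem_Icc.2 hT))
  exact ⟨_, (Real.summable_pow_div_factorial (K * ‖α‖ * T)).mul_left A, fun j t ht =>
    (norm_oscInt_add_le hK rfl ω hA j t ht).trans
      (mul_pow_div_factorial_le hA0 (by positivity) ht j)⟩

end Volterra

/-! ### Collecting powers of the frequency -/

section Reorder

variable {X : Type*} [NormedAddCommGroup X] [NormedSpace ℂ X]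
  {S : ℝ → X →L[ℂ] X} {α : X →L[ℂ] X} {u₀ : X} {L : X →ₗ.[ℂ] X}

/-- The partial sums, collected by powers of `ω`. -/
theorem sum_serS_eq (n : ℕ) (ω t : ℝ) :
    ∑ d ∈ Finset.Icc 1 n, serS L S α u₀ ω n d t =
      ∑ r ∈ Finset.Icc 1 n, ((1 : ℂ) / (ω : ℂ) ^ r) • ∑ s ∈ Finset.range (r + 1),
        osc ω s t • coefP L S α u₀ r s t := by
  -- The common summand of both sides, with `r = d + q` the power of `1/ω` and `s = d - l` the
  -- frequency.
  let G : ℕ → ℕ → ℕ → X := fun d r s => ∑ k ∈ multiIdx d (r - d),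
    (1 / (Complex.I * (ω : ℂ)) ^ r) • (((coefA k d s : ℚ) : ℂ) * osc ω s t) •
      app (opN L α k (d - s + 1) d) (S t (app (opF L α k (d - s)) u₀))
  have hl : ∀ d, serS L S α u₀ ω n d t =
      ∑ q ∈ Finset.range (n - d + 1), ∑ s ∈ Finset.range (d + 1), G d (d + q) s := by
    intro d
    refine Finset.sum_congr rfl fun q _ => ?_
    rw [Finset.sum_comm]
    rw [Nat.add_sub_cancel_left]
    refine Finset.sum_congr rfl fun k _ => ?_
    rw [← Finset.smul_sum]
    congr 1
    rw [← Finset.sum_flip]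
    refine Finset.sum_congr rfl fun l hl => ?_
    rw [Finset.mem_range] at hl
    rw [Nat.sub_sub_self (by omega)]
  have hr : ∀ r, ((1 : ℂ) / (ω : ℂ) ^ r) • ∑ s ∈ Finset.range (r + 1),
      osc ω s t • coefP L S α u₀ r s t =
      ∑ s ∈ Finset.range (r + 1), ∑ d ∈ Finset.Icc (max s 1) r, G d r s := by
    intro r
    simp only [coefP, Finset.smul_sum, G, smul_smul]
    refine Finset.sum_congr rfl fun s _ => Finset.sum_congr rfl fun d _ =>
      Finset.sum_congr rfl fun k _ => ?_
    congr 1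
    rw [mul_pow]
    simp only [div_eq_mul_inv, mul_inv]
    ring
  simp only [hl, hr]
  simp only [Finset.sum_sigma']
  refine Finset.sum_nbij' (fun x => ⟨x.1 + x.2.1, x.2.2, x.1⟩)
    (fun y => ⟨y.2.2, y.1 - y.2.2, y.2.1⟩) ?_ ?_ ?_ ?_ ?_
  · rintro ⟨d, q, s⟩ h
    simp only [Finset.mem_sigma, Finset.mem_range, Finset.mem_Icc] at h ⊢
    omega
  · rintro ⟨r, s, d⟩ h
    simp only [Finset.mem_sigma, Finset.mem_range, Finset.mem_Icc] at h ⊢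
    omega
  · rintro ⟨d, q, s⟩ h
    simp
  · rintro ⟨r, s, d⟩ h
    simp only [Finset.mem_sigma, Finset.mem_range, Finset.mem_Icc] at h
    simp only [Nat.add_sub_cancel' h.2.2.2]
  · rintro ⟨d, q, s⟩ h
    rfl

end Reorder

/-! ### Bounds uniform in time and frequency -/

section BigO

variable {X : Type*} [NormedAddCommGroup X] {T : ℝ} {N : ℕ}

/-- `f ω t = O(ω^{-N})` uniformly in `t ∈ [0, T]` and for all `ω > 0`. -/
def UnifBigO (T : ℝ) (N : ℕ) (f : ℝ → ℝ → X) : Prop :=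
  ∃ C : ℝ, ∀ ω : ℝ, 0 < ω → ∀ t ∈ Icc 0 T, ‖f ω t‖ ≤ C / ω ^ N

theorem UnifBigO.congr {f g : ℝ → ℝ → X} (hf : UnifBigO T N f)
    (h : ∀ ω : ℝ, 0 < ω → ∀ t ∈ Icc 0 T, g ω t = f ω t) : UnifBigO T N g := by
  obtain ⟨C, hC⟩ := hf
  exact ⟨C, fun ω hω t ht => by rw [h ω hω t ht]; exact hC ω hω t ht⟩

theorem UnifBigO.add {f g : ℝ → ℝ → X} (hf : UnifBigO T N f) (hg : UnifBigO T N g) :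
    UnifBigO T N fun ω t => f ω t + g ω t := by
  obtain ⟨C, hC⟩ := hf
  obtain ⟨D, hD⟩ := hg
  refine ⟨C + D, fun ω hω t ht => (norm_add_le _ _).trans ?_⟩
  rw [add_div]
  exact add_le_add (hC ω hω t ht) (hD ω hω t ht)

theorem UnifBigO.sum {κ : Type*} {s : Finset κ} {f : κ → ℝ → ℝ → X}
    (h : ∀ i ∈ s, UnifBigO T N (f i)) : UnifBigO T N fun ω t => ∑ i ∈ s, f i ω t := by
  choose! C hC using h
  refine ⟨∑ i ∈ s, C i, fun ω hω t ht => (norm_sum_le _ _).trans ?_⟩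
  rw [Finset.sum_div]
  exact Finset.sum_le_sum fun i hi => hC i hi ω hω t ht

theorem unifBigO_of_continuousOn {f : ℝ → X} (hf : ContinuousOn f (Icc 0 T)) :
    UnifBigO T 0 fun _ t => f t := by
  obtain ⟨C, hC⟩ := isCompact_Icc.exists_bound_of_continuousOn hf
  exact ⟨C, fun ω _ t ht => by simpa using hC t ht⟩

variable [NormedSpace ℂ X]

theorem UnifBigO.const_smul {f : ℝ → ℝ → X} (hf : UnifBigO T N f) (c : ℂ) :
    UnifBigO T N fun ω t => c • f ω t := by
  obtain ⟨C, hC⟩ := hf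
  refine ⟨‖c‖ * C, fun ω hω t ht => ?_⟩
  rw [norm_smul, mul_div_assoc]
  exact mul_le_mul_of_nonneg_left (hC ω hω t ht) (norm_nonneg _)

theorem UnifBigO.osc_smul {f : ℝ → ℝ → X} (hf : UnifBigO T N f) (s : ℕ) :
    UnifBigO T N fun ω t => osc ω s t • f ω t := by
  obtain ⟨C, hC⟩ := hf
  refine ⟨C, fun ω hω t ht => ?_⟩
  rw [norm_smul, norm_osc, one_mul]
  exact hC ω hω t ht

theorem UnifBigO.inv_pow_smul {f : ℝ → ℝ → X} (hf : UnifBigO T 0 f) (N : ℕ) :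
    UnifBigO T N fun ω t => (1 / (Complex.I * (ω : ℂ)) ^ N) • f ω t := by
  obtain ⟨C, hC⟩ := hf
  refine ⟨C, fun ω hω t ht => ?_⟩
  have := hC ω hω t ht
  rw [pow_zero, div_one] at this
  have h1 : ‖(1 / (Complex.I * (ω : ℂ)) ^ N)‖ = 1 / ω ^ N := by
    simp [abs_of_pos hω]
  rw [norm_smul, h1, one_div_mul_eq_div]
  have := pow_pos hω N
  gcongr

theorem UnifBigO.convolution [CompleteSpace X] {S : ℝ → X →L[ℂ] X} (hS : IsC0Semigroup S)
    (B : X →L[ℂ] X) {f : ℝ → ℝ → X} (hf : UnifBigO T N f) :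
    UnifBigO T N fun ω t => ∫ τ in (0 : ℝ)..t, S (t - τ) (B (f ω τ)) := by
  obtain ⟨C, hC⟩ := hf
  obtain ⟨K, -, hK⟩ := hS.exists_bound T
  refine ⟨K * ‖B‖ * C * T, fun ω hω t ht => ?_⟩
  have hK0 : 0 ≤ K := (norm_nonneg _).trans (hK t ht)
  have hC0 : 0 ≤ C / ω ^ N := (norm_nonneg _).trans (hC ω hω t ht)
  have := intervalIntegral.norm_integral_le_of_norm_le_const (a := 0) (b := t)
    (f := fun τ => S (t - τ) (B (f ω τ))) (C := K * (‖B‖ * (C / ω ^ N))) fun τ hτ => by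
      rw [uIoc_of_le ht.1] at hτ
      exact (S (t - τ)).le_of_opNorm_le_of_le
        (hK _ ⟨sub_nonneg.2 hτ.2, (sub_le_self _ hτ.1.le).trans ht.2⟩)
        (B.le_opNorm_of_le (hC ω hω τ ⟨hτ.1.le, hτ.2.trans ht.2⟩))
  refine this.trans ?_
  rw [sub_zero, abs_of_nonneg ht.1]
  calc K * (‖B‖ * (C / ω ^ N)) * t ≤ K * (‖B‖ * (C / ω ^ N)) * T := by
        have := ht.2
        gcongr
    _ = _ := by ring

end BigO

/-! ### Order of the remainder and expansion of the solution -/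

section Remainder

variable {X : Type*} [NormedAddCommGroup X] [NormedSpace ℂ X] [CompleteSpace X]
  {H : ℕ → Type*} [∀ j, NormedAddCommGroup (H j)] [∀ j, NormedSpace ℂ (H j)]
  [∀ j, CompleteSpace (H j)]
  {L : X →ₗ.[ℂ] X} {S : ℝ → X →L[ℂ] X} {α : X →L[ℂ] X} {ι : ∀ j, H j →L[ℂ] X} {M : ℕ}
  {u₀ : X} {T : ℝ}

omit [CompleteSpace X] [∀ j, CompleteSpace (H j)] in
theorem IsScale.mono (h : IsScale L S α ι M) {N : ℕ} (hN : N ≤ M) : IsScale L S α ι N where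
  injective := h.injective
  antitone := h.antitone
  gen j hj := h.gen j (hj.trans hN)
  mul j hj := h.mul j (hj.trans hN)
  orbit j hj := h.orbit j (hj.trans hN)

theorem IsScale.continuousOn_vecN (h : IsScale L S α ι M) (hS : IsC0Semigroup S)
    (hLS : IsGenerator L S) (hu : u₀ ∈ range (ι M)) {k : ℕ → ℕ} {l d q : ℕ} (hl : l ≤ d)
    (hk : k ∈ multiIdx d q) (hq : q ≤ M) : ContinuousOn (vecN L S α u₀ k l d) (Icc 0 T) :=
  (h.wellDefined hS hLS hu hl (by rw [sum_of_mem_multiIdx hk]; exact hq)).2.2.mono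
    Icc_subset_Ici_self

theorem IsScale.continuousOn_errE (h : IsScale L S α ι M) (hS : IsC0Semigroup S)
    (hLS : IsGenerator L S) (hu : u₀ ∈ range (ι M)) (hT : 0 ≤ T) {ω : ℝ} (hω : 0 < ω) {d : ℕ}
    (hd : d ≤ M) : ContinuousOn (errE L S α u₀ ω M d) (Icc 0 T) :=
  ((continuousOn_oscInt hS hT ω d).sub
    ((h.continuousOn_serS hS hLS hu hd ω).mono Icc_subset_Ici_self)).congr fun t ht => by
      rw [Pi.sub_apply, h.oscInt_eq hS hLS hu hω hd ht.1, add_sub_cancel_left]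

/-- The integrals carry `ω^{-M}` explicitly and have integrands bounded independently of `ω`; the
recursive convolution preserves the order. -/
theorem IsScale.unifBigO_errE (h : IsScale L S α ι M) (hS : IsC0Semigroup S)
    (hLS : IsGenerator L S) (hu : u₀ ∈ range (ι M)) (d : ℕ) :
    UnifBigO T M fun ω t => errE L S α u₀ ω M d t := by
  induction d with
  | zero => exact ⟨0, fun ω _ t _ => by simp [errE]⟩
  | succ d ih =>
    simp only [errE_succ]
    refine UnifBigO.add (UnifBigO.sum fun k hk => UnifBigO.sum fun l hl =>
      ((UnifBigO.const_smul ?_ _).inv_pow_smul M)) ((ih.osc_smul 1).convolution hS α)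
    rw [Finset.mem_range] at hl
    have hv := h.continuousOn_vecN hS hLS hu hl.le hk (Nat.sub_le M d) (T := T)
    have := ((unifBigO_of_continuousOn hv).osc_smul (d + 1 - l)).convolution hS
      (ContinuousLinearMap.id ℂ X)
    simp only [ContinuousLinearMap.id_apply, map_smul] at this
    exact this

/-- The terms of highest order in the expansion `S^d_N`. -/
noncomputable def topTerm (L : X →ₗ.[ℂ] X) (S : ℝ → X →L[ℂ] X) (α : X →L[ℂ] X) (u₀ : X) (ω : ℝ)
    (N d : ℕ) (t : ℝ) : X :=
  ∑ k ∈ multiIdx d (N - d), (1 / (Complex.I * ω) ^ (d + (N - d))) • ∑ l ∈ Finset.range (d + 1),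
    (((coefA k d (d - l) : ℚ) : ℂ) * osc ω (d - l) t) • vecN L S α u₀ k l d t

omit [CompleteSpace X] in
theorem serS_eq_topTerm_self (ω : ℝ) (N : ℕ) (t : ℝ) :
    serS L S α u₀ ω N N t = topTerm L S α u₀ ω N N t := by
  rw [serS, topTerm, Nat.sub_self, zero_add, Finset.sum_range_one]
  rfl

omit [CompleteSpace X] in
-- Raising `N` by one adds precisely the multi-indices of length `N + 1 - d`.
theorem serS_succ_left (ω : ℝ) {N d : ℕ} (hd : d ≤ N) (t : ℝ) :
    serS L S α u₀ ω (N + 1) d t = serS L S α u₀ ω N d t + topTerm L S α u₀ ω (N + 1) d t := by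
  rw [serS, serS, topTerm, Nat.succ_sub hd, Finset.sum_range_succ]
  rfl

theorem IsScale.unifBigO_topTerm (h : IsScale L S α ι M) (hS : IsC0Semigroup S)
    (hLS : IsGenerator L S) (hu : u₀ ∈ range (ι M)) {d : ℕ} (hd : d ≤ M) :
    UnifBigO T M fun ω t => topTerm L S α u₀ ω M d t := by
  unfold topTerm
  rw [Nat.add_sub_cancel' hd]
  refine UnifBigO.sum fun k hk => UnifBigO.inv_pow_smul (UnifBigO.sum fun l hl => ?_) M
  rw [Finset.mem_range, Nat.lt_succ_iff] at hl
  simp only [mul_smul]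
  exact ((unifBigO_of_continuousOn
    (h.continuousOn_vecN hS hLS hu hl hk (Nat.sub_le M d))).osc_smul _).const_smul _

/-- The last unit of regularity allows expansion to order `n + 1`, which supplies the extra power of
`1/ω` both in `E^d_n` and in the tail. -/
theorem IsScale.unifBigO_remR {n : ℕ} (h : IsScale L S α ι (n + 1)) (hS : IsC0Semigroup S)
    (hLS : IsGenerator L S) (hu : u₀ ∈ range (ι (n + 1))) (hT : 0 ≤ T) :
    UnifBigO T (n + 1) fun ω t => remR L S α u₀ ω n t := by
  have hun := h.antitone _ _ n.le_succ hu
  refine UnifBigO.add (UnifBigO.sum fun d hd => ?_) ?_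
  · obtain ⟨-, hd⟩ := Finset.mem_Icc.1 hd
    refine ((h.unifBigO_topTerm hS hLS hu (d := d) (by omega)).add
      (h.unifBigO_errE hS hLS hu d)).congr fun ω hω t ht => ?_
    -- The expansions of one `T^d` at orders `n` and `n + 1` are compared; the common `S^d_n`
    -- cancels.
    have h1 := (h.mono n.le_succ).oscInt_eq hS hLS hun hω hd ht.1
    rw [h.oscInt_eq hS hLS hu hω (by omega : d ≤ n + 1) ht.1, serS_succ_left ω hd, add_assoc,
      add_right_inj] at h1
    exact h1.symm
  · have h1 : UnifBigO T (n + 1) fun ω t => oscInt S α u₀ ω (n + 1) t := by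
      refine ((h.unifBigO_topTerm hS hLS hu le_rfl).add
        (h.unifBigO_errE hS hLS hu (n + 1))).congr fun ω hω t ht => ?_
      rw [← serS_eq_topTerm_self]
      exact h.oscInt_eq hS hLS hu hω le_rfl ht.1
    obtain ⟨C, hC⟩ := h1
    obtain ⟨K, -, hK⟩ := hS.exists_bound T
    have hK0 : 0 ≤ K := (norm_nonneg _).trans (hK 0 (left_mem_Icc.2 hT))
    have hsum := Real.summable_pow_div_factorial (K * ‖α‖ * T)
    refine ⟨C * ∑' j : ℕ, (K * ‖α‖ * T) ^ j / j.factorial, fun ω hω t ht => ?_⟩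
    have hC0 : 0 ≤ C / ω ^ (n + 1) := (norm_nonneg _).trans (hC ω hω t ht)
    rw [mul_div_right_comm]
    -- The bound for `T^{n+1}` is the amplitude of the whole exponential majorant, so the constant
    -- is free of `ω`.
    exact tsum_of_norm_bounded (hsum.hasSum.mul_left _) fun j =>
      (norm_oscInt_add_le hK rfl ω (hC ω hω) j t ht).trans
        (mul_pow_div_factorial_le hC0 (by positivity) ht j)

theorem IsScale.continuousOn_remR {n : ℕ} (h : IsScale L S α ι n) (hS : IsC0Semigroup S)
    (hLS : IsGenerator L S) (hu : u₀ ∈ range (ι n)) (hT : 0 ≤ T) {ω : ℝ} (hω : 0 < ω) :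
    ContinuousOn (remR L S α u₀ ω n) (Icc 0 T) := by
  obtain ⟨b, hb, hbound⟩ := exists_norm_oscInt_le hS ω hT (n + 1) (α := α) (u₀ := u₀)
  exact (continuousOn_finsetSum _ fun d hd =>
    h.continuousOn_errE hS hLS hu hT hω (Finset.mem_Icc.1 hd).2).add
    (continuousOn_tsum (fun j => continuousOn_oscInt hS hT ω _) hb hbound)

theorem IsScale.solution_eq {n : ℕ} (h : IsScale L S α ι n) (hS : IsC0Semigroup S)
    (hLS : IsGenerator L S) (hu₀ : u₀ ∈ range (ι n)) {ω : ℝ} (hω : 0 < ω) {u : ℝ → X}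
    (hu : IsSolution L α u₀ ω T u) {t : ℝ} (ht : t ∈ Icc 0 T) :
    u t = S t u₀ + ∑ r ∈ Finset.Icc 1 n, ((1 : ℂ) / (ω : ℂ) ^ r) •
      ∑ s ∈ Finset.range (r + 1), osc ω s t • coefP L S α u₀ r s t + remR L S α u₀ ω n t := by
  have hsum : Summable fun d => oscInt S α u₀ ω d t := by
    obtain ⟨b, hb, hbound⟩ := exists_norm_oscInt_le hS ω (ht.1.trans ht.2) 0 (α := α) (u₀ := u₀)
    exact Summable.of_norm_bounded hb fun j => by simpa using hbound j t ht
  have h1 := (hu.hasSum_oscInt hS hLS ht hsum).tsum_eq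
  rw [← hsum.sum_add_tsum_nat_add (n + 1), Finset.sum_range_succ'] at h1
  have h2 : ∑ d ∈ Finset.range n, oscInt S α u₀ ω (d + 1) t =
      ∑ d ∈ Finset.Icc 1 n, (serS L S α u₀ ω n d t + errE L S α u₀ ω n d t) := by
    refine Finset.sum_nbij' (fun d => d + 1) (fun d => d - 1) ?_ ?_ ?_ ?_ ?_
    · intro d hd
      rw [Finset.mem_range] at hd
      exact Finset.mem_Icc.2 ⟨by omega, by omega⟩
    · intro d hd
      rw [Finset.mem_Icc] at hd
      exact Finset.mem_range.2 (by omega)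
    · intro d _
      simp
    · intro d hd
      rw [Finset.mem_Icc] at hd
      exact Nat.sub_add_cancel hd.1
    · intro d hd
      rw [Finset.mem_range] at hd
      exact h.oscInt_eq hS hLS hu₀ hω hd ht.1
  have h3 : ∀ i, oscInt S α u₀ ω (i + (n + 1)) t = oscInt S α u₀ ω (n + 1 + i) t := fun i => by
    rw [add_comm]
  rw [← h1, h2, Finset.sum_add_distrib, sum_serS_eq, remR,
    show oscInt S α u₀ ω 0 t = S t u₀ from rfl]
  simp only [h3]
  abel

end Remainder

/-! ### Derivatives of test functions -/

section TestDeriv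

variable {m : ℕ} {Ω : TopologicalSpace.Opens (E m)}

theorem lineDerivOp_testFunction_apply (v : E m) (φ : 𝓓(Ω, ℂ)) (x : E m) :
    (∂_{v} φ : 𝓓(Ω, ℂ)) x = fderiv ℝ φ x v := by
  rw [TestFunction.lineDerivOp_eq_lineDerivCLM ℝ, TestFunction.lineDerivCLM_apply, if_pos (by simp)]
  exact (φ.contDiff.differentiable (by simp) x).lineDeriv_eq_fderiv

theorem lineDerivOp_comm (v w : E m) (φ : 𝓓(Ω, ℂ)) :
    (∂_{v} (∂_{w} φ : 𝓓(Ω, ℂ)) : 𝓓(Ω, ℂ)) = ∂_{w} (∂_{v} φ : 𝓓(Ω, ℂ)) := by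
  ext x
  have hd : DifferentiableAt ℝ (fderiv ℝ φ) x :=
    ((φ.contDiff.fderiv_right (m := 1) (by norm_cast)).differentiable (by simp)) x
  have key : ∀ v w : E m, (∂_{v} (∂_{w} φ : 𝓓(Ω, ℂ)) : 𝓓(Ω, ℂ)) x =
      fderiv ℝ (fderiv ℝ φ) x v w := by
    intro v w
    rw [lineDerivOp_testFunction_apply]
    have : ((∂_{w} φ : 𝓓(Ω, ℂ)) : E m → ℂ) = fun y => fderiv ℝ φ y w :=
      funext fun y => lineDerivOp_testFunction_apply w φ y
    rw [this, fderiv_clm_apply hd (differentiableAt_const w)]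
    simp
  rw [key, key]
  exact (φ.contDiff.contDiffAt.isSymmSndFDerivAt
    (by simpa using WithTop.coe_le_coe.2 (le_top : (2 : ℕ∞) ≤ ⊤))).eq v w

/-- Partial derivatives of test functions commute, so the two coordinatewise folds can be
interleaved. -/
theorem testDeriv_add (β γ : Fin m → ℕ) (φ : 𝓓(Ω, ℂ)) :
    testDeriv (β + γ) φ = testDeriv β (testDeriv γ φ) := by
  let D : Fin m → 𝓓(Ω, ℂ) → 𝓓(Ω, ℂ) := fun i χ => ∂_{(EuclideanSpace.single i (1 : ℝ) : E m)} χ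
  have hD : ∀ i j, Function.Commute (D i) (D j) := fun i j φ => lineDerivOp_comm _ _ φ
  have hfold : ∀ (l : List (Fin m)) (i : Fin m) (n : ℕ) (β : Fin m → ℕ) (φ : 𝓓(Ω, ℂ)),
      (D i)^[n] (l.foldr (fun j ψ => (D j)^[β j] ψ) φ) =
        l.foldr (fun j ψ => (D j)^[β j] ψ) ((D i)^[n] φ) := by
    intro l i n β φ
    induction l with
    | nil => rfl
    | cons j l ih =>
      simp only [List.foldr_cons]
      rw [← ih, ((hD i j).iterate_iterate n (β j)).eq]
  have key : ∀ l : List (Fin m), l.foldr (fun j ψ => (D j)^[(β + γ) j] ψ) φ =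
      l.foldr (fun j ψ => (D j)^[β j] ψ) (l.foldr (fun j ψ => (D j)^[γ j] ψ) φ) := by
    intro l
    induction l with
    | nil => rfl
    | cons j l ih =>
      simp only [List.foldr_cons]
      rw [ih, ← hfold, Pi.add_apply, Function.iterate_add_apply]
  exact key _

theorem testDeriv_zero (φ : 𝓓(Ω, ℂ)) : testDeriv 0 φ = φ := by
  unfold testDeriv
  induction List.finRange m <;> simp

theorem testDeriv_single (i : Fin m) (φ : 𝓓(Ω, ℂ)) :
    testDeriv (Pi.single i 1) φ = ∂_{(EuclideanSpace.single i (1 : ℝ) : E m)} φ := by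
  have key : ∀ l : List (Fin m), l.Nodup →
      l.foldr (fun j ψ => (fun χ : 𝓓(Ω, ℂ) => ∂_{(EuclideanSpace.single j (1 : ℝ) : E m)} χ)^[
        (Pi.single i 1 : Fin m → ℕ) j] ψ) φ =
      if i ∈ l then (∂_{(EuclideanSpace.single i (1 : ℝ) : E m)} φ : 𝓓(Ω, ℂ)) else φ := by
    intro l hl
    induction l with
    | nil => rfl
    | cons j l ih =>
      rw [List.nodup_cons] at hl
      rw [List.foldr_cons, ih hl.2]
      rcases eq_or_ne i j with rfl | hij
      · simp [hl.1]
      · simp [hij, hij.symm]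
  rw [testDeriv, key _ (List.nodup_finRange m), if_pos (List.mem_finRange i)]

end TestDeriv

/-! ### Weak derivatives: linearity, iteration, uniqueness -/

section WeakDeriv

variable {m : ℕ} {Ω : TopologicalSpace.Opens (E m)} {f f' g g' : E m → ℂ} {β γ : Fin m → ℕ}

/-- Lebesgue measure on `Ω`. -/
noncomputable abbrev vol (Ω : TopologicalSpace.Opens (E m)) : Measure (E m) :=
  (volume : Measure (E m)).restrict (Ω : Set (E m))

theorem ord_add (β γ : Fin m → ℕ) : ord (β + γ) = ord β + ord γ := by
  simp [ord, Finset.sum_add_distrib]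

theorem ord_single (i : Fin m) : ord (Pi.single i 1) = 1 := by
  simp [ord]

theorem exists_eq_single_add (hβ : β ≠ 0) :
    ∃ (i : Fin m) (γ : Fin m → ℕ), β = Pi.single i 1 + γ := by
  obtain ⟨i, hi⟩ := Function.ne_iff.1 hβ
  refine ⟨i, β - Pi.single i 1, ?_⟩
  rw [add_tsub_cancel_of_le]
  intro j
  rcases eq_or_ne j i with rfl | hj
  · simpa [Nat.one_le_iff_ne_zero] using hi
  · simp [hj]

theorem hasWeakDeriv_zero (f : E m → ℂ) : HasWeakDeriv Ω 0 f f := fun φ => by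
  simp [testDeriv_zero, ord]

theorem HasWeakDeriv.congr (h : HasWeakDeriv Ω β f g) (hf : f' =ᵐ[vol Ω] f) (hg : g' =ᵐ[vol Ω] g) :
    HasWeakDeriv Ω β f' g' := by
  intro φ
  have h1 : (fun x => f' x * testDeriv β φ x) =ᵐ[vol Ω] fun x => f x * testDeriv β φ x := by
    filter_upwards [hf] with x hx using by rw [hx]
  have h2 : (fun x => g' x * φ x) =ᵐ[vol Ω] fun x => g x * φ x := by
    filter_upwards [hg] with x hx using by rw [hx]
  rw [integral_congr_ae h1, integral_congr_ae h2]
  exact h φ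

/-- Higher weak derivatives are iterated weak derivatives. -/
theorem HasWeakDeriv.add_iff (h : HasWeakDeriv Ω β f g) :
    HasWeakDeriv Ω (β + γ) f f' ↔ HasWeakDeriv Ω γ g f' := by
  refine forall_congr' fun φ => ?_
  rw [testDeriv_add, h, ord_add, pow_add, mul_assoc]
  exact mul_right_inj' (pow_ne_zero _ (neg_ne_zero.2 one_ne_zero))

/-- The exponent is left free because both `q = 2` and `q = ∞` are needed. -/
theorem integrable_mul_testFunction {q : ℝ≥0∞} (hq : 1 ≤ q) (hf : MemLp f q (vol Ω))
    (φ : 𝓓(Ω, ℂ)) : Integrable (fun x => f x * φ x) (vol Ω) := by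
  have := TestFunction.integrable_bilin (ContinuousLinearMap.mul ℝ ℂ) (μ := vol Ω)
    ((hf.locallyIntegrable hq).locallyIntegrableOn _) φ
  simpa only [ContinuousLinearMap.mul_apply', mul_comm] using this

theorem HasWeakDeriv.add {q : ℝ≥0∞} (hq : 1 ≤ q) (h : HasWeakDeriv Ω β f g)
    (h' : HasWeakDeriv Ω β f' g') (hf : MemLp f q (vol Ω)) (hf' : MemLp f' q (vol Ω))
    (hg : MemLp g q (vol Ω)) (hg' : MemLp g' q (vol Ω)) :
    HasWeakDeriv Ω β (f + f') (g + g') := by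
  intro φ
  simp only [Pi.add_apply, add_mul]
  rw [integral_add (integrable_mul_testFunction hq hf _) (integrable_mul_testFunction hq hf' _),
    integral_add (integrable_mul_testFunction hq hg _) (integrable_mul_testFunction hq hg' _),
    h, h', mul_add]

theorem HasWeakDeriv.const_mul (c : ℂ) (h : HasWeakDeriv Ω β f g) :
    HasWeakDeriv Ω β (c • f) (c • g) := by
  intro φ
  simp only [Pi.smul_apply, smul_eq_mul, mul_assoc, integral_const_mul]
  rw [h]
  ring

/-- A real smooth function with compact support in `Ω`, as a complex test function. -/
noncomputable def testOfReal (g : E m → ℝ) (hg : ContDiff ℝ ((⊤ : ℕ∞) : WithTop ℕ∞) g)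
    (hc : HasCompactSupport g) (hs : tsupport g ⊆ Ω) : 𝓓(Ω, ℂ) where
  toFun x := (g x : ℂ)
  contDiff' := Complex.ofRealCLM.contDiff.comp hg
  hasCompactSupport' := hc.comp_left (g := fun y : ℝ => (y : ℂ)) Complex.ofReal_zero
  tsupport_subset' :=
    (tsupport_comp_subset (g := fun y : ℝ => (y : ℂ)) Complex.ofReal_zero g).trans hs

/-- Weak derivatives are unique. -/
theorem HasWeakDeriv.unique {q : ℝ≥0∞} (hq : 1 ≤ q) (h : HasWeakDeriv Ω β f g)
    (h' : HasWeakDeriv Ω β f g') (hg : MemLp g q (vol Ω)) (hg' : MemLp g' q (vol Ω)) :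
    g =ᵐ[vol Ω] g' := by
  -- The fundamental lemma of the calculus of variations tests against real functions, whence
  -- `testOfReal`.
  have key := Ω.isOpen.ae_eq_zero_of_integral_contDiff_smul_eq_zero (μ := vol Ω)
    (((hg.sub hg').locallyIntegrable hq).locallyIntegrableOn _) fun χ hχ hc hs => by
      have h1 := (h (testOfReal χ hχ hc hs)).symm.trans (h' (testOfReal χ hχ hc hs))
      rw [mul_right_inj' (pow_ne_zero _ (neg_ne_zero.2 one_ne_zero)), ← sub_eq_zero,
        ← integral_sub (integrable_mul_testFunction hq hg _)
          (integrable_mul_testFunction hq hg' _)] at h1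
      rw [← h1]
      refine integral_congr_ae (Eventually.of_forall fun x => ?_)
      simp only [Pi.sub_apply, Complex.real_smul, ← sub_mul]
      exact mul_comm _ _
  filter_upwards [key, ae_restrict_mem Ω.isOpen.measurableSet] with x hx hxΩ
  exact sub_eq_zero.1 (hx hxΩ)

end WeakDeriv

/-! ### Mollification and the Leibniz rule -/

section Mollify

variable {m : ℕ} {Ω : TopologicalSpace.Opens (E m)}

/-- A mollifier supported in the ball of radius `2 / (n + 1)`. -/
noncomputable def bump (m n : ℕ) : ContDiffBump (0 : E m) where
  rIn := 1 / (n + 1)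
  rOut := 2 / (n + 1)
  rIn_pos := by positivity
  rIn_lt_rOut := by gcongr; norm_num

theorem tendsto_rOut_bump (m : ℕ) : Tendsto (fun n => (bump m n).rOut) atTop (𝓝 0) := by
  have := (tendsto_one_div_add_atTop_nhds_zero_nat (𝕜 := ℝ)).const_mul 2
  simp only [mul_zero, mul_one_div] at this
  exact this

/-- The mollification of a function on `Ω`, extended by zero. -/
noncomputable def mollify (Ω : TopologicalSpace.Opens (E m)) (n : ℕ) (f : E m → ℂ) : E m → ℂ :=
  convolution ((bump m n).normed volume) ((Ω : Set (E m)).indicator f)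
    (ContinuousLinearMap.lsmul ℝ ℝ) volume

variable {f g : E m → ℂ} {C : ℝ}

theorem locallyIntegrable_indicator (hf : Measurable f) (hC : ∀ x, ‖f x‖ ≤ C) :
    LocallyIntegrable ((Ω : Set (E m)).indicator f) := by
  refine (memLp_top_of_bound (hf.indicator Ω.isOpen.measurableSet).aestronglyMeasurable C
    (Eventually.of_forall fun x => ?_)).locallyIntegrable le_top
  exact (norm_indicator_le_norm_self _ _).trans (hC x)

theorem contDiff_mollify (hf : Measurable f) (hC : ∀ x, ‖f x‖ ≤ C) (n : ℕ) :
    ContDiff ℝ ((⊤ : ℕ∞) : WithTop ℕ∞) (mollify Ω n f) :=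
  (bump m n).hasCompactSupport_normed.contDiff_convolution_left _ (bump m n).contDiff_normed
    (locallyIntegrable_indicator hf hC)

/-- Almost every point is a Lebesgue point, and the radii of the mollifiers have bounded ratio; `K =
2` is that ratio. -/
theorem ae_tendsto_mollify (hf : Measurable f) (hC : ∀ x, ‖f x‖ ≤ C) :
    ∀ᵐ x ∂vol Ω, Tendsto (fun n => mollify Ω n f x) atTop (𝓝 (f x)) := by
  have h := ContDiffBump.ae_convolution_tendsto_right_of_locallyIntegrable (K := 2)
    (tendsto_rOut_bump m) (Eventually.of_forall fun n => by simp [bump, div_eq_mul_inv])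
    (locallyIntegrable_indicator (Ω := Ω) hf hC)
  filter_upwards [ae_restrict_of_ae h, ae_restrict_mem Ω.isOpen.measurableSet] with x hx hxΩ
  rwa [indicator_of_mem hxΩ] at hx

theorem norm_mollify_le (hC : ∀ x, ‖f x‖ ≤ C) (n : ℕ) (x : E m) : ‖mollify Ω n f x‖ ≤ C := by
  rw [mollify, convolution_def]
  refine (norm_integral_le_of_norm_le (g := fun t => (bump m n).normed volume t * C)
    ((bump m n).integrable_normed.mul_const C) (Eventually.of_forall fun t => ?_)).trans ?_
  · rw [ContinuousLinearMap.lsmul_apply, norm_smul, Real.norm_of_nonneg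
      ((bump m n).nonneg_normed t)]
    exact mul_le_mul_of_nonneg_left ((norm_indicator_le_norm_self _ _).trans (hC _))
      ((bump m n).nonneg_normed t)
  · rw [integral_mul_const, (bump m n).integral_normed, one_mul]

/-- Mollification commutes with weak derivatives, away from the boundary. -/
theorem fderiv_mollify {i : Fin m} (hf : Measurable f) (hC : ∀ x, ‖f x‖ ≤ C)
    (h : HasWeakDeriv Ω (Pi.single i 1) f g) {n : ℕ} {x : E m}
    (hx : Metric.closedBall x (bump m n).rOut ⊆ Ω) :
    fderiv ℝ (mollify Ω n f) x (EuclideanSpace.single i 1) = mollify Ω n g x := by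
  set ψ := (bump m n).normed (volume : Measure (E m)) with hψ
  have hψd : ContDiff ℝ ((⊤ : ℕ∞) : WithTop ℕ∞) ψ := (bump m n).contDiff_normed
  have hd := ((bump m n).hasCompactSupport_normed.hasFDerivAt_convolution_left
    (ContinuousLinearMap.lsmul ℝ ℝ) ((bump m n).contDiff_normed (μ := volume))
    (locallyIntegrable_indicator (Ω := Ω) hf hC) x)
  have hsub : ContDiff ℝ ((⊤ : ℕ∞) : WithTop ℕ∞) fun y => ψ (x - y) :=
    hψd.comp (contDiff_const.sub contDiff_id)
  have hsupp : tsupport (fun y => ψ (x - y)) ⊆ Metric.closedBall x (bump m n).rOut := by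
    refine closure_minimal (fun y hy => ?_) Metric.isClosed_closedBall
    have : x - y ∈ Function.support ψ := hy
    rw [hψ, (bump m n).support_normed_eq, mem_ball_zero_iff, ← dist_eq_norm, dist_comm] at this
    exact this.le
  have hcs : HasCompactSupport (fun y => ψ (x - y)) :=
    HasCompactSupport.of_support_subset_isCompact (isCompact_closedBall x _)
      (subset_closure.trans hsupp)
  -- The reflected mollifier is an admissible test function because the ball around `x` lies in `Ω`.
  -- Its reflection produces a sign that cancels the one in the weak derivative.
  let χ : 𝓓(Ω, ℂ) := testOfReal (fun y => ψ (x - y)) hsub hcs (hsupp.trans hx)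
  have hχ := h χ
  rw [testDeriv_single, ord_single, pow_one, neg_one_mul] at hχ
  have hχd : ∀ y, (∂_{(EuclideanSpace.single i (1 : ℝ) : E m)} χ : 𝓓(Ω, ℂ)) y =
      -((fderiv ℝ ψ (x - y) (EuclideanSpace.single i 1) : ℝ) : ℂ) := by
    intro y
    rw [lineDerivOp_testFunction_apply]
    have h1 : HasFDerivAt (fun y => ψ (x - y)) (-fderiv ℝ ψ (x - y)) y := by
      have h2 : HasFDerivAt (fun y => ψ (x - y))
          ((fderiv ℝ ψ (x - y)).comp (-ContinuousLinearMap.id ℝ (E m))) y :=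
        HasFDerivAt.comp (g := ψ) (f := fun y => x - y) y
          (hψd.differentiable (by simp) (x - y)).hasFDerivAt ((hasFDerivAt_id y).const_sub x)
      refine h2.congr_fderiv ?_
      ext v
      simp
    have h3 := (Complex.ofRealCLM.hasFDerivAt.comp y h1).fderiv
    change fderiv ℝ (Complex.ofRealCLM ∘ fun y => ψ (x - y)) y _ = _
    rw [h3]
    simp
  have hint := ((bump m n).hasCompactSupport_normed.fderiv ℝ).convolutionExists_left
    ((ContinuousLinearMap.lsmul ℝ ℝ).precompL (E m))
    (((bump m n).contDiff_normed (μ := volume) (n := 1)).continuous_fderiv one_ne_zero)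
    (locallyIntegrable_indicator (Ω := Ω) hf hC) x
  have hsmul : ∀ (F : E m → ℂ) (r : E m → ℝ),
      ∫ y, r y • (Ω : Set (E m)).indicator F y = ∫ y in (Ω : Set (E m)), F y * (r y : ℂ) := by
    intro F r
    rw [← integral_indicator Ω.isOpen.measurableSet]
    congr 1
    funext y
    by_cases hy : y ∈ (Ω : Set (E m))
    · simp [hy, mul_comm]
    · simp [hy]
  change fderiv ℝ (convolution _ _ _ _) x _ = _
  rw [hd.fderiv, mollify, convolution_eq_swap, convolution_eq_swap,
    ContinuousLinearMap.integral_apply hint.integrable_swap]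
  simp only [ContinuousLinearMap.precompL_apply, ContinuousLinearMap.lsmul_apply]
  rw [hsmul, hsmul]
  simp only [hχd, mul_neg, integral_neg, neg_inj] at hχ
  exact hχ

/-- The product of a smooth function and a test function. -/
noncomputable def mulTest (g : E m → ℂ) (hg : ContDiff ℝ ((⊤ : ℕ∞) : WithTop ℕ∞) g)
    (φ : 𝓓(Ω, ℂ)) : 𝓓(Ω, ℂ) where
  toFun x := g x * φ x
  contDiff' := hg.mul φ.contDiff
  hasCompactSupport' := φ.hasCompactSupport.mul_left
  tsupport_subset' := (tsupport_mul_subset_right).trans φ.tsupport_subset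

/-- Leibniz rule for the product with a bounded function. -/
theorem HasWeakDeriv.mul_of_bound {q : ℝ≥0∞} (hq : 1 ≤ q) {i : Fin m} {a a' : E m → ℂ} {C' : ℝ}
    (ha : Measurable a) (ha' : Measurable a') (hC : ∀ x, ‖a x‖ ≤ C) (hC' : ∀ x, ‖a' x‖ ≤ C')
    (h : HasWeakDeriv Ω (Pi.single i 1) a a') (hf : MemLp f q (vol Ω)) (hg : MemLp g q (vol Ω))
    (h' : HasWeakDeriv Ω (Pi.single i 1) f g) :
    HasWeakDeriv Ω (Pi.single i 1) (fun x => a x * f x) (fun x => a' x * f x + a x * g x) := by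
  intro φ
  rw [testDeriv_single, ord_single, pow_one, neg_one_mul]
  set φ' : 𝓓(Ω, ℂ) := ∂_{(EuclideanSpace.single i (1 : ℝ) : E m)} φ with hφ'
  -- The support of `φ` has positive distance to the complement of `Ω`, so mollification eventually
  -- commutes with the derivative there.
  obtain ⟨δ, hδ, hδΩ⟩ := (show IsCompact (tsupport φ) from φ.hasCompactSupport)
    |>.exists_cthickening_subset_open Ω.isOpen φ.tsupport_subset
  have hball : ∀ᶠ n in atTop, ∀ x ∈ tsupport φ,
      Metric.closedBall x (bump m n).rOut ⊆ (Ω : Set (E m)) := by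
    filter_upwards [(tendsto_rOut_bump m).eventually (gt_mem_nhds hδ)] with n hn x hx
    exact ((Metric.closedBall_subset_closedBall hn.le).trans
      (Metric.closedBall_subset_cthickening hx δ)).trans hδΩ
  have hlim : ∀ {F b : E m → ℂ} {D : ℝ} (χ : 𝓓(Ω, ℂ)), MemLp F q (vol Ω) → Measurable b →
      (∀ x, ‖b x‖ ≤ D) → Tendsto (fun n => ∫ x in (Ω : Set (E m)), mollify Ω n b x * (F x * χ x))
        atTop (𝓝 (∫ x in (Ω : Set (E m)), b x * (F x * χ x))) := by
    intro F b D χ hF hb hD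
    have hi := integrable_mul_testFunction hq hF χ
    refine tendsto_integral_of_dominated_convergence (fun x => D * ‖F x * χ x‖) (fun n => ?_)
      (hi.norm.const_mul D) (fun n => Eventually.of_forall fun x => ?_) ?_
    · exact (contDiff_mollify hb hD n).continuous.aestronglyMeasurable.mul hi.aestronglyMeasurable
    · rw [norm_mul]
      exact mul_le_mul_of_nonneg_right (norm_mollify_le hD n x) (norm_nonneg _)
    · filter_upwards [ae_tendsto_mollify hb hD] with x hx using hx.mul_const _
  have hinte : ∀ {F b : E m → ℂ} {D : ℝ} (χ : 𝓓(Ω, ℂ)), MemLp F q (vol Ω) → Measurable b →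
      (∀ x, ‖b x‖ ≤ D) → Integrable (fun x => b x * (F x * χ x)) (vol Ω) := fun χ hF hb hD =>
    (integrable_mul_testFunction hq hF χ).bdd_mul hb.aestronglyMeasurable
      (Eventually.of_forall hD)
  -- The mollified `a` is smooth, so its product with `φ` may be tested against the weak derivative
  -- of `f`.
  have heq : ∀ᶠ n in atTop, ∫ x in (Ω : Set (E m)), mollify Ω n a x * (f x * φ' x) =
      -((∫ x in (Ω : Set (E m)), mollify Ω n a' x * (f x * φ x)) +
        ∫ x in (Ω : Set (E m)), mollify Ω n a x * (g x * φ x)) := by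
    filter_upwards [hball] with n hn
    have hmc := contDiff_mollify (Ω := Ω) ha hC n
    have hΦ := h' (mulTest (mollify Ω n a) hmc φ)
    rw [testDeriv_single, ord_single, pow_one, neg_one_mul] at hΦ
    have hΦd : ∀ x, (∂_{(EuclideanSpace.single i (1 : ℝ) : E m)}
        (mulTest (mollify Ω n a) hmc φ) : 𝓓(Ω, ℂ)) x =
        mollify Ω n a x * φ' x + mollify Ω n a' x * φ x := by
      intro x
      rw [lineDerivOp_testFunction_apply, hφ', lineDerivOp_testFunction_apply]
      change fderiv ℝ (fun x => mollify Ω n a x * φ x) x _ = _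
      rw [fderiv_fun_mul (hmc.differentiable (by simp) x) (φ.contDiff.differentiable (by simp) x)]
      simp only [add_apply, smul_apply, smul_eq_mul]
      congr 1
      -- Off the support the factor `φ x` vanishes, so nothing need be known about the mollification
      -- near the boundary.
      by_cases hx : x ∈ tsupport φ
      · rw [fderiv_mollify ha hC h (hn x hx), mul_comm]
      · rw [image_eq_zero_of_notMem_tsupport hx]; simp
    have h1 : ∀ x, f x * (∂_{(EuclideanSpace.single i (1 : ℝ) : E m)}
        (mulTest (mollify Ω n a) hmc φ) : 𝓓(Ω, ℂ)) x =
        mollify Ω n a x * (f x * φ' x) + mollify Ω n a' x * (f x * φ x) := fun x => by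
      rw [hΦd]; ring
    have h2 : ∀ x, g x * mulTest (mollify Ω n a) hmc φ x = mollify Ω n a x * (g x * φ x) :=
      fun x => by
        change g x * (mollify Ω n a x * φ x) = _
        ring
    simp only [h1, h2] at hΦ
    rw [integral_add (hinte φ' hf hmc.continuous.measurable (norm_mollify_le hC n))
      (hinte φ hf (contDiff_mollify ha' hC' n).continuous.measurable (norm_mollify_le hC' n))]
      at hΦ
    rw [neg_add, ← hΦ]
    ring
  have hl := tendsto_nhds_unique_of_eventuallyEq (hlim φ' hf ha hC)
    ((hlim φ hf ha' hC').add (hlim φ hg ha hC)).neg heq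
  rw [← integral_add (hinte φ hf ha' hC') (hinte φ hg ha hC)] at hl
  calc _ = _ := by simp only [mul_assoc]
    _ = _ := hl
    _ = _ := by simp only [add_mul, mul_assoc]

end Mollify

/-! ### Sobolev spaces and multiplication -/

section SobolevSpaces

variable {m : ℕ} {Ω : TopologicalSpace.Opens (E m)} {q : ℝ≥0∞}

/-- `f ∈ W^{k,q}(Ω)`. -/
def MemW (Ω : TopologicalSpace.Opens (E m)) (k : ℕ) (f : Lp ℂ q (vol Ω)) : Prop :=
  ∀ β : Fin m → ℕ, ord β ≤ k → ∃ g : Lp ℂ q (vol Ω), HasWeakDeriv Ω β f g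

variable {f g : Lp ℂ q (vol Ω)} {k j : ℕ} {β γ : Fin m → ℕ}

theorem MemW.mono (h : MemW Ω k f) (hj : j ≤ k) : MemW Ω j f := fun β hβ => h β (hβ.trans hj)

theorem MemW.weakDeriv (h : MemW Ω (ord β + k) f) (hg : HasWeakDeriv Ω β f g) : MemW Ω k g := by
  intro γ hγ
  obtain ⟨g', hg'⟩ := h (β + γ) (by rw [ord_add]; lia)
  exact ⟨g', hg.add_iff.1 hg'⟩

theorem memW_zero (f : Lp ℂ q (vol Ω)) : MemW Ω 0 f := by
  intro β hβ
  obtain rfl : β = 0 := by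
    ext i
    have := Finset.sum_eq_zero_iff.1 (Nat.le_zero.1 hβ) i (Finset.mem_univ i)
    simpa using this
  exact ⟨f, hasWeakDeriv_zero _⟩

theorem memW_succ (h : ∀ i, ∃ g : Lp ℂ q (vol Ω), HasWeakDeriv Ω (Pi.single i 1) f g ∧ MemW Ω k g) :
    MemW Ω (k + 1) f := by
  intro β hβ
  rcases eq_or_ne β 0 with rfl | h0
  · exact ⟨f, hasWeakDeriv_zero _⟩
  · obtain ⟨i, γ, rfl⟩ := exists_eq_single_add h0
    obtain ⟨g, hg, hgk⟩ := h i
    rw [ord_add, ord_single] at hβ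
    obtain ⟨g', hg'⟩ := hgk γ (by lia)
    exact ⟨g', hg.add_iff.2 hg'⟩

theorem HasWeakDeriv.add_Lp [hq : Fact (1 ≤ q)] {f' g' : Lp ℂ q (vol Ω)}
    (h : HasWeakDeriv Ω β f g) (h' : HasWeakDeriv Ω β f' g') :
    HasWeakDeriv Ω β (f + f' : Lp ℂ q (vol Ω)) (g + g' : Lp ℂ q (vol Ω)) :=
  (h.add hq.out h' (Lp.memLp f) (Lp.memLp f') (Lp.memLp g) (Lp.memLp g')).congr
    (Lp.coeFn_add _ _) (Lp.coeFn_add _ _)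

theorem HasWeakDeriv.smul_Lp (c : ℂ) (h : HasWeakDeriv Ω β f g) :
    HasWeakDeriv Ω β (c • f : Lp ℂ q (vol Ω)) (c • g : Lp ℂ q (vol Ω)) :=
  (h.const_mul c).congr (Lp.coeFn_smul _ _) (Lp.coeFn_smul _ _)

theorem HasWeakDeriv.unique_Lp [hq : Fact (1 ≤ q)] {f : E m → ℂ} (h : HasWeakDeriv Ω β f g)
    {g' : Lp ℂ q (vol Ω)} (h' : HasWeakDeriv Ω β f g') : g = g' :=
  Lp.ext (h.unique hq.out h' (Lp.memLp g) (Lp.memLp g'))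

theorem hasWeakDeriv_zero_Lp (β : Fin m → ℕ) :
    HasWeakDeriv Ω β (0 : Lp ℂ q (vol Ω)) (0 : Lp ℂ q (vol Ω)) := by
  have h : HasWeakDeriv Ω β 0 0 := fun φ => by simp
  exact h.congr (Lp.coeFn_zero ..) (Lp.coeFn_zero ..)

theorem MemW.add [hq : Fact (1 ≤ q)] (hf : MemW Ω k f) (hg : MemW Ω k g) : MemW Ω k (f + g) := by
  intro β hβ
  obtain ⟨f', hf'⟩ := hf β hβ
  obtain ⟨g', hg'⟩ := hg β hβ
  exact ⟨f' + g', hf'.add_Lp hg'⟩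

theorem MemW.sum [hq : Fact (1 ≤ q)] {κ : Type*} {s : Finset κ} {F : κ → Lp ℂ q (vol Ω)}
    (h : ∀ i ∈ s, MemW Ω k (F i)) : MemW Ω k (∑ i ∈ s, F i) :=
  Finset.sum_induction F (MemW Ω k) (fun _ _ => MemW.add)
    (fun β _ => ⟨0, hasWeakDeriv_zero_Lp β⟩) h

/-- Truncation at the essential supremum: the mollification lemmas require a bound at every point.
-/
theorem exists_bounded_representative (α : LInf Ω) :
    ∃ (a : E m → ℂ) (C : ℝ), Measurable a ∧ (∀ x, ‖a x‖ ≤ C) ∧ α =ᵐ[vol Ω] a := by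
  have hm : Measurable α := (Lp.stronglyMeasurable α).measurable
  refine ⟨{x | ‖α x‖ ≤ ‖α‖}.indicator α, ‖α‖,
    hm.indicator (measurableSet_le hm.norm measurable_const), fun x => ?_, ?_⟩
  · by_cases hx : ‖α x‖ ≤ ‖α‖
    · rwa [indicator_of_mem (by exact hx)]
    · rw [indicator_of_notMem (by exact hx), norm_zero]
      exact norm_nonneg _
  · have hfin : eLpNorm α ∞ (vol Ω) ≠ ∞ := (Lp.memLp α).2.ne
    filter_upwards [enorm_ae_le_eLpNormEssSup α (vol Ω)] with x hx
    rw [indicator_of_mem]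
    rw [← eLpNorm_exponent_top] at hx
    rw [Set.mem_ofPred_eq, Lp.norm_def, ← toReal_enorm]
    exact ENNReal.toReal_mono hfin hx

theorem hasWeakDeriv_mulOp {i : Fin m} {α α' : LInf Ω} {v v' : L2 Ω}
    (h : HasWeakDeriv Ω (Pi.single i 1) α α') (hv : HasWeakDeriv Ω (Pi.single i 1) v v') :
    HasWeakDeriv Ω (Pi.single i 1) (mulOp α v) (mulOp α' v + mulOp α v' : L2 Ω) := by
  obtain ⟨a, C, ha, hC, haα⟩ := exists_bounded_representative α
  obtain ⟨a', C', ha', hC', haα'⟩ := exists_bounded_representative α'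
  refine (HasWeakDeriv.mul_of_bound one_le_two ha ha' hC hC' (h.congr haα.symm haα'.symm)
    (Lp.memLp v) (Lp.memLp v') hv).congr ?_ ?_
  · filter_upwards [coeFn_mulOp α v, haα] with x h1 h2
    rw [h1, h2]
  · filter_upwards [Lp.coeFn_add (mulOp α' v) (mulOp α v'), coeFn_mulOp α' v, coeFn_mulOp α v', haα,
      haα'] with x h0 h1 h2 h3 h4
    rw [h0, Pi.add_apply, h1, h2, h3, h4]

/-- By the Leibniz rule each first derivative is a sum of two products of regularity `k`, and
induction applies to both. -/
theorem MemW.mulOp {α : LInf Ω} {v : L2 Ω} (hα : MemW Ω k α) (hv : MemW Ω k v) :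
    MemW Ω k (mulOp α v) := by
  induction k generalizing α v with
  | zero => exact memW_zero _
  | succ k ih =>
    refine memW_succ fun i => ?_
    have hi : ord (Pi.single i 1 : Fin m → ℕ) + k = k + 1 := by rw [ord_single, add_comm]
    obtain ⟨α', hα'⟩ := hα (Pi.single i 1) (by lia)
    obtain ⟨v', hv'⟩ := hv (Pi.single i 1) (by lia)
    exact ⟨_, hasWeakDeriv_mulOp hα' hv',
      (ih ((hi ▸ hα : MemW Ω (ord _ + k) α).weakDeriv hα') (hv.mono (by lia))).add
        (ih (hα.mono (by lia)) ((hi ▸ hv : MemW Ω (ord _ + k) v).weakDeriv hv'))⟩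

end SobolevSpaces

/-! ### Smooth bounded coefficients as multipliers -/

section SmoothCoefficients

variable {m : ℕ} {Ω : TopologicalSpace.Opens (E m)} {a : E m → ℂ}

theorem MemCbInf.memLp (h : MemCbInf Ω a) : MemLp a ∞ (vol Ω) := by
  obtain ⟨M, hM⟩ := h.2 0
  refine memLp_top_of_bound (h.1.continuousOn.aestronglyMeasurable Ω.isOpen.measurableSet) M ?_
  filter_upwards [ae_restrict_mem Ω.isOpen.measurableSet] with x hx
  simpa using hM x hx

theorem MemCbInf.fderiv_apply (h : MemCbInf Ω a) (v : E m) :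
    MemCbInf Ω fun x => fderiv ℝ a x v := by
  have hd : ContDiffOn ℝ ((⊤ : ℕ∞) : WithTop ℕ∞) (fderiv ℝ a) (Ω : Set (E m)) :=
    h.1.fderiv_of_isOpen Ω.isOpen le_rfl
  refine ⟨hd.clm_apply contDiffOn_const, fun j => ?_⟩
  obtain ⟨M, hM⟩ := h.2 (j + 1)
  refine ⟨‖v‖ * M, fun x hx => ?_⟩
  refine (norm_iteratedFDeriv_clm_apply_const (hd.contDiffAt (Ω.isOpen.mem_nhds hx))
    (WithTop.coe_le_coe.2 le_top)).trans ?_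
  rw [norm_iteratedFDeriv_fderiv]
  exact mul_le_mul_of_nonneg_left (hM x hx) (norm_nonneg v)

/-- Nothing is known of `a` outside `Ω`. Products with test functions vanish there, so the integrals
extend to the whole space, where integration by parts needs differentiability of `a` only on the
support of `φ`. -/
theorem MemCbInf.hasWeakDeriv (h : MemCbInf Ω a) (i : Fin m) :
    HasWeakDeriv Ω (Pi.single i 1) a fun x => fderiv ℝ a x (EuclideanSpace.single i 1) := by
  intro φ
  rw [testDeriv_single, ord_single, pow_one, neg_one_mul]
  set e : E m := EuclideanSpace.single i 1
  have hout : ∀ (χ : 𝓓(Ω, ℂ)) (F : E m → ℂ), ∀ x ∉ (Ω : Set (E m)), F x * χ x = 0 := by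
    intro χ F x hx
    rw [image_eq_zero_of_notMem_tsupport fun h => hx (χ.tsupport_subset h), mul_zero]
  have hint : ∀ (χ : 𝓓(Ω, ℂ)) {F : E m → ℂ}, MemLp F ∞ (vol Ω) →
      Integrable (fun x => F x * χ x) := fun χ F hF =>
    (integrableOn_iff_integrable_of_support_subset
      (Function.support_subset_iff'.2 (hout χ F))).1 (integrable_mul_testFunction le_top hF χ)
  rw [setIntegral_eq_integral_of_forall_compl_eq_zero (hout _ _),
    setIntegral_eq_integral_of_forall_compl_eq_zero (hout φ _)]
  simp only [lineDerivOp_testFunction_apply]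
  refine integral_mul_fderiv_eq_neg_fderiv_mul_of_integrable (hint φ (h.fderiv_apply e).memLp)
    ?_ (hint φ h.memLp) (fun x hx => ?_) (fun x _ => φ.contDiff.differentiable (by simp) x)
  · simpa only [lineDerivOp_testFunction_apply] using hint (∂_{e} φ) h.memLp
  · exact (h.1.contDiffAt (Ω.isOpen.mem_nhds (φ.tsupport_subset hx))).differentiableAt (by simp)

theorem MemCbInf.memW (h : MemCbInf Ω a) (k : ℕ) {α : LInf Ω} (hα : α =ᵐ[vol Ω] a) :
    MemW Ω k α := by
  induction k generalizing a α with
  | zero => exact memW_zero _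
  | succ k ih =>
    refine memW_succ fun i => ?_
    have h' := h.fderiv_apply (EuclideanSpace.single i 1)
    exact ⟨h'.memLp.toLp _, (h.hasWeakDeriv i).congr hα h'.memLp.coeFn_toLp,
      ih h' h'.memLp.coeFn_toLp⟩

end SmoothCoefficients

/-! ### The scale of Sobolev spaces of a differential operator -/

section SobolevScale

variable {m : ℕ} {Ω : TopologicalSpace.Opens (E m)} {k : ℕ} {β : Fin m → ℕ}

theorem mem_idxLE : β ∈ idxLE m k ↔ ord β ≤ k := by
  refine Finset.mem_disjiUnion.trans ?_
  simp [Finset.mem_piAntidiag, ord]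

theorem coeFn_sum_Lp {κ : Type*} (s : Finset κ) (F : κ → L2 Ω) :
    (∑ i ∈ s, F i : L2 Ω) =ᵐ[vol Ω] ∑ i ∈ s, (F i : E m → ℂ) := by
  classical
  induction s using Finset.induction_on with
  | empty => simpa using Lp.coeFn_zero ℂ 2 (vol Ω)
  | insert i s hi ih =>
    rw [Finset.sum_insert hi, Finset.sum_insert hi]
    exact (Lp.coeFn_add _ _).trans (EventuallyEq.rfl.add ih)

/-- Integration against a test function, as a functional on `L²(Ω)`. -/
theorem exists_clm_integral_mul (φ : 𝓓(Ω, ℂ)) :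
    ∃ Φ : L2 Ω →L[ℂ] ℂ, ∀ v : L2 Ω, Φ v = ∫ x in (Ω : Set (E m)), v x * φ x := by
  have hφ : MemLp (fun x => (starRingEnd ℂ) (φ x)) 2 (vol Ω) :=
    ((Complex.continuous_conj.comp φ.contDiff.continuous).memLp_of_hasCompactSupport
      (φ.hasCompactSupport.comp_left (map_zero _))).restrict _
  refine ⟨innerSL ℂ (hφ.toLp _), fun v => ?_⟩
  rw [innerSL_apply_apply, L2.inner_def]
  refine integral_congr_ae ?_
  filter_upwards [hφ.coeFn_toLp] with x hx
  rw [hx]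
  simp

/-- Each test function imposes an equation between continuous functionals on `L²(Ω)`; completeness
of `Sob` rests on this. -/
theorem isClosed_hasWeakDeriv (β : Fin m → ℕ) :
    IsClosed {z : L2 Ω × L2 Ω | HasWeakDeriv Ω β z.1 z.2} := by
  simp only [HasWeakDeriv, Set.ofPred_forall]
  refine isClosed_iInter fun φ => ?_
  obtain ⟨Φ, hΦ⟩ := exists_clm_integral_mul φ
  obtain ⟨Ψ, hΨ⟩ := exists_clm_integral_mul (testDeriv β φ)
  simp only [← hΦ, ← hΨ]
  exact isClosed_eq (by fun_prop) (by fun_prop)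

/-- The multi-index `0`. -/
def zeroIdx (m k : ℕ) : {β // β ∈ idxLE m k} := ⟨0, mem_idxLE.2 (by simp [ord])⟩

/-- The Sobolev space `H^k(Ω)`, as the space of tuples of weak derivatives. -/
noncomputable def Sob (Ω : TopologicalSpace.Opens (E m)) (k : ℕ) :
    Submodule ℂ ({β // β ∈ idxLE m k} → L2 Ω) where
  carrier := {D | ∀ β : {β // β ∈ idxLE m k}, HasWeakDeriv Ω β.1 (D (zeroIdx m k)) (D β)}
  add_mem' {D D'} hD hD' β := HasWeakDeriv.add_Lp (f := D (zeroIdx m k)) (g := D β)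
    (f' := D' (zeroIdx m k)) (g' := D' β) (hD β) (hD' β)
  zero_mem' β := hasWeakDeriv_zero_Lp β.1
  smul_mem' c D hD β := HasWeakDeriv.smul_Lp (β := β.1) (f := D (zeroIdx m k)) (g := D β) c (hD β)

theorem isClosed_sob (Ω : TopologicalSpace.Opens (E m)) (k : ℕ) :
    IsClosed (Sob Ω k : Set ({β // β ∈ idxLE m k} → L2 Ω)) := by
  change IsClosed {D : {β // β ∈ idxLE m k} → L2 Ω |
    ∀ β : {β // β ∈ idxLE m k}, HasWeakDeriv Ω β.1 (D (zeroIdx m k)) (D β)}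
  simp only [Set.ofPred_forall]
  refine isClosed_iInter fun β => ?_
  have hc : Continuous fun D : {β // β ∈ idxLE m k} → L2 Ω => (D (zeroIdx m k), D β) := by fun_prop
  exact IsClosed.preimage hc (isClosed_hasWeakDeriv β.1)

instance (Ω : TopologicalSpace.Opens (E m)) (k : ℕ) : CompleteSpace (Sob Ω k) :=
  (isClosed_sob Ω k).completeSpace_coe

/-- The embedding of `H^k(Ω)` into `L²(Ω)`. -/
noncomputable def sobEmb (Ω : TopologicalSpace.Opens (E m)) (k : ℕ) : Sob Ω k →L[ℂ] L2 Ω :=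
  (ContinuousLinearMap.proj (zeroIdx m k)).comp (Sob Ω k).subtypeL

theorem sobEmb_injective (Ω : TopologicalSpace.Opens (E m)) (k : ℕ) :
    Function.Injective (sobEmb Ω k) := by
  rintro ⟨D, hD⟩ ⟨D', hD'⟩ h
  have h0 : D (zeroIdx m k) = D' (zeroIdx m k) := h
  exact Subtype.ext (funext fun β => (hD β).unique_Lp (h0 ▸ hD' β))

theorem mem_range_sobEmb {v : L2 Ω} : v ∈ range (sobEmb Ω k) ↔ MemH Ω k v := by
  constructor
  · rintro ⟨⟨D, hD⟩, rfl⟩ β hβ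
    exact ⟨D ⟨β, mem_idxLE.2 hβ⟩, hD ⟨β, mem_idxLE.2 hβ⟩⟩
  · intro h
    choose D hD using fun β : {β // β ∈ idxLE m k} => h β.1 (mem_idxLE.1 β.2)
    have h0 : v = D (zeroIdx m k) := HasWeakDeriv.unique_Lp (hasWeakDeriv_zero _) (hD (zeroIdx m k))
    exact ⟨⟨D, fun β => h0 ▸ hD β⟩, h0.symm⟩

variable {p N : ℕ} {a : (Fin m → ℕ) → E m → ℂ} {L : L2 Ω →ₗ.[ℂ] L2 Ω} {S : ℝ → L2 Ω →L[ℂ] L2 Ω}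
  {α : LInf Ω} {u₀ : L2 Ω}

/-- Each `∂^β v` with `|β| ≤ p` keeps `k` derivatives, and the coefficients are multipliers of
`H^k(Ω)`. -/
theorem IsDiffOp.exists_sends (hL : IsDiffOp Ω p a L) (ha : ∀ β, ord β ≤ p → MemCbInf Ω (a β))
    {v : L2 Ω} (hv : MemH Ω (p + k) v) : ∃ w, MemH Ω k w ∧ Sends L v w := by
  choose! D hD using fun β (hβ : ord β ≤ p) => hv β (hβ.trans (Nat.le_add_right p k))
  have hA : ∀ β, ∃ A : LInf Ω, ord β ≤ p → A =ᵐ[vol Ω] a β := fun β => by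
    by_cases hβ : ord β ≤ p
    · exact ⟨(ha β hβ).memLp.toLp _, fun _ => (ha β hβ).memLp.coeFn_toLp⟩
    · exact ⟨0, fun h => absurd h hβ⟩
  choose A hA using hA
  obtain ⟨h, hLv⟩ := hL v D hD
  refine ⟨∑ β ∈ idxLE m p, mulOp (A β) (D β), MemW.sum fun β hβ => ?_, h, Lp.ext (hLv.trans ?_)⟩
  · rw [mem_idxLE] at hβ
    exact ((ha β hβ).memW k (hA β hβ)).mulOp
      ((MemW.mono hv (by lia : ord β + k ≤ p + k)).weakDeriv (hD β hβ))
  · have h1 : ∀ᵐ x ∂vol Ω, ∀ β ∈ idxLE m p, mulOp (A β) (D β) x = a β x * D β x := by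
      rw [Filter.eventually_all_finset]
      intro β hβ
      filter_upwards [coeFn_mulOp (A β) (D β), hA β (mem_idxLE.1 hβ)] with x h1 h2
      rw [h1, h2]
    filter_upwards [h1, coeFn_sum_Lp (idxLE m p) fun β => mulOp (A β) (D β)] with x h1 h2
    rw [h2, Finset.sum_apply]
    exact Finset.sum_congr rfl fun β hβ => (h1 β hβ).symm

theorem IsC0OnH.exists_orbit (h : IsC0OnH Ω S k) {v : L2 Ω} (hv : MemH Ω k v) :
    ∃ g : ℝ → Sob Ω k, ContinuousOn g (Ici 0) ∧ ∀ t, 0 ≤ t → sobEmb Ω k (g t) = S t v := by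
  choose g hg hgd using fun β : {β // β ∈ idxLE m k} => h v hv β.1 (mem_idxLE.1 β.2)
  have h0 : ∀ t, 0 ≤ t → S t v = g (zeroIdx m k) t := fun t ht =>
    HasWeakDeriv.unique_Lp (hasWeakDeriv_zero _) (hgd (zeroIdx m k) t ht)
  -- The weak derivatives are given only for `t ≥ 0`; freezing the tuple at time zero keeps it in
  -- `Sob` for negative `t`.
  refine ⟨fun t => ⟨fun β => g β (max t 0), fun β => ?_⟩, Continuous.continuousOn ?_,
    fun t ht => ?_⟩
  · change HasWeakDeriv Ω β.1 (g (zeroIdx m k) (max t 0)) _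
    rw [← h0 _ (le_max_right t 0)]
    exact hgd β _ (le_max_right t 0)
  · refine Continuous.subtype_mk (continuous_pi fun β => ?_) _
    exact (hg β).comp_continuous (by fun_prop) fun t => le_max_right t 0
  · rw [h0 t ht, ← max_eq_left ht]
    change g (zeroIdx m k) (max (max t 0) 0) = _
    rw [max_eq_left (le_max_right t 0)]

/-- The spaces `H^{jp}(Ω)` form a scale for the differential operator `L`. -/
theorem Regular.isScale (h : Regular Ω p S α u₀ N) (hL : IsDiffOp Ω p a L)
    (ha : ∀ β, ord β ≤ p → MemCbInf Ω (a β)) :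
    IsScale L S (mulOp α) (fun j => sobEmb Ω (j * p)) N where
  injective j := sobEmb_injective Ω (j * p)
  antitone i j hij v hv := mem_range_sobEmb.2
    (MemW.mono (mem_range_sobEmb.1 hv) (Nat.mul_le_mul_right p hij))
  gen j _ v hv := by
    rw [mem_range_sobEmb, add_mul, one_mul, add_comm] at hv
    obtain ⟨w, hw, hvw⟩ := hL.exists_sends ha hv
    exact ⟨w, mem_range_sobEmb.2 hw, hvw⟩
  mul j hj v hv := mem_range_sobEmb.2
    (MemW.mulOp (MemW.mono h.coef (Nat.mul_le_mul_right p hj)) (mem_range_sobEmb.1 hv))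
  orbit j hj v hv := (h.wellPosed j hj).exists_orbit (mem_range_sobEmb.1 hv)

theorem Regular.init_mem_range (h : Regular Ω p S α u₀ N) : u₀ ∈ range (sobEmb Ω (N * p)) :=
  mem_range_sobEmb.2 h.init

end SobolevScale

end ModFourier

/-! ### The theorem for the Sobolev scale -/

theorem mainTheorem3 {m : ℕ} (Ω : TopologicalSpace.Opens (EuclideanSpace ℝ (Fin m)))
    (p : ℕ) (hp : 0 < p)
    (a : (Fin m → ℕ) → EuclideanSpace ℝ (Fin m) → ℂ) (ha : ∀ β, ord β ≤ p → MemCbInf Ω (a β))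
    (L : L2 Ω →ₗ.[ℂ] L2 Ω) (hL : IsDiffOp Ω p a L)
    (S : ℝ → L2 Ω →L[ℂ] L2 Ω) (hS : IsC0Semigroup S) (hLS : IsGenerator L S)
    (T : ℝ) (hT : 0 < T) (n : ℕ) (α : LInf Ω) (u₀ : L2 Ω)
    (hreg : Regular Ω p S α u₀ (n + 1)) :
    -- every vector `N_{k_{l+1}}^{k_d} e^{tL} F_l u₀` that occurs is well defined
    (∀ (k : ℕ → ℕ) (d l : ℕ), l ≤ d → ∑ i ∈ Finset.Icc 1 d, k i ≤ n + 1 →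
      u₀ ∈ (opF L (mulOp α) k l).domain ∧
      (∀ t ∈ Set.Icc 0 T,
        S t (app (opF L (mulOp α) k l) u₀) ∈ (opN L (mulOp α) k (l + 1) d).domain) ∧
      ContinuousOn (fun t => app (opN L (mulOp α) k (l + 1) d)
        (S t (app (opF L (mulOp α) k l) u₀))) (Set.Icc 0 T)) ∧
    -- the constant depends on `n`, `T`, `L`, `u₀`, `α` only
    ∃ C : ℝ, ∀ ω : ℝ, 0 < ω →
      -- the expansion of the solution
      (∀ u : ℝ → L2 Ω, IsSolution L (mulOp α) u₀ ω T u → ∀ t ∈ Set.Icc 0 T,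
        u t = S t u₀
          + ∑ r ∈ Finset.Icc 1 n, ((1 : ℂ) / (ω : ℂ) ^ r) • ∑ s ∈ Finset.range (r + 1),
              osc ω s t • coefP L S (mulOp α) u₀ r s t
          + remR L S (mulOp α) u₀ ω n t) ∧
      -- the series in the remainder converges in `C([0, T]; L²(Ω))`
      (∀ d, ContinuousOn (oscInt S (mulOp α) u₀ ω d) (Set.Icc 0 T)) ∧
      HasSumUniformlyOn (fun (j : ℕ) (t : ℝ) => oscInt S (mulOp α) u₀ ω (n + 1 + j) t)
        (fun t => ∑' j : ℕ, oscInt S (mulOp α) u₀ ω (n + 1 + j) t) (Set.Icc 0 T) ∧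
      -- explicit form of the terms of that series, as far as the regularity of the data allows
      (∀ d, n + 1 ≤ d → Regular Ω p S α u₀ d → ∀ t ∈ Set.Icc 0 T,
        oscInt S (mulOp α) u₀ ω d t
          = serS L S (mulOp α) u₀ ω d d t + errE L S (mulOp α) u₀ ω d d t) ∧
      ((∀ d, Regular Ω p S α u₀ d) → ∀ t ∈ Set.Icc 0 T,
        remR L S (mulOp α) u₀ ω n t
          = ∑ d ∈ Finset.Icc 1 n, errE L S (mulOp α) u₀ ω n d t
            + ∑' j : ℕ, (serS L S (mulOp α) u₀ ω (n + 1 + j) (n + 1 + j) t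
              + errE L S (mulOp α) u₀ ω (n + 1 + j) (n + 1 + j) t)) ∧
      -- the estimate of the remainder in `C([0, T]; L²(Ω))`
      ContinuousOn (remR L S (mulOp α) u₀ ω n) (Set.Icc 0 T) ∧
      ∀ t ∈ Set.Icc 0 T, ‖remR L S (mulOp α) u₀ ω n t‖ ≤ C / ω ^ (n + 1) := by

  have hsc := hreg.isScale hL ha
  -- Order `n` suffices for the expansion itself; order `n + 1` enters through well-definedness and
  -- the remainder estimate.
  have hsc' := hsc.mono n.le_succ
  have hu := hreg.init_mem_range
  have hu' := hsc.antitone _ _ n.le_succ hu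
  refine ⟨fun k d l hl hk => ?_, ?_⟩
  · obtain ⟨h1, h2, h3⟩ := hsc.wellDefined hS hLS hu hl hk
    exact ⟨h1, fun t ht => h2 t ht.1, h3.mono Set.Icc_subset_Ici_self⟩
  obtain ⟨C, hC⟩ := hsc.unifBigO_remR hS hLS hu hT.le
  refine ⟨C, fun ω hω => ⟨fun u hsol t ht => hsc'.solution_eq hS hLS hu' hω hsol ht,
    fun d => continuousOn_oscInt hS hT.le ω d, ?_, ?_, fun hall t ht => ?_,
    hsc'.continuousOn_remR hS hLS hu' hT.le hω, hC ω hω⟩⟩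
  · obtain ⟨b, hb, hle⟩ := exists_norm_oscInt_le hS ω hT.le (n + 1) (α := mulOp α) (u₀ := u₀)
    exact HasSumUniformlyOn.of_norm_le_summable hb hle
  · exact fun d _ hd t ht =>
      (hd.isScale hL ha).oscInt_eq hS hLS hd.init_mem_range hω le_rfl ht.1
  · rw [remR]
    congr 1
    exact tsum_congr fun j => ((hall (n + 1 + j)).isScale hL ha).oscInt_eq hS hLS
      (hall (n + 1 + j)).init_mem_range hω le_rfl ht.1
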